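/- Let $S\subset\mathbb R^3$ be a finite non-empty set, let $m\ge 0$, and let $$\phi(x)=m+\sum_{p\in S}\frac1{2|x-p|}.$$ Let $\pi:X\to\mathbb R^3\setminus S$ be the principal circle bundle with connection form $\eta$ satisfying $d\eta=-\ast d\phi$ (fibres of period $2\pi$), equipped with the Gibbons–Hawking metric $g=\phi^{-1}\eta^2+\phi\,\pi^*g_{\mathbb R^3}$. (The full Gibbons–Hawking manifold is obtained from $X$ by adding one point above each $p\in S$; all the assertions below concern only a neighbourhood of a circle fibre in $X$.) A closed geodesic $\gamma$ is a smooth loop with non-zero velocity and $D\dot\gamma/dt=0$. Its index is the largest dimension of a space of smooth periodic normal vector fields $V$ along $\gamma$ on which $V\mapsto-\int g(V,J_\gamma V)\,dt$ is negative definite, where $J_\gamma V=\frac{D^2V}{dt^2}-\mathrm{Riem}(\dot\gamma,V)\dot\gamma$. It is stable to second order if its index is $0$, and stable if it is a local minimum of the length functional $\ell$ among smooth loops (neighbourhoods being those of the $C^1$ topology). Let $G\subset O(3)$ be the group of linear isometries of $\mathbb R^3$ that map $S$ onto itself, acting by precomposition on the space $\mathcal H_2$ of real harmonic homogeneous polynomials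 of degree $2$ in three variables, and let $\mathcal H_2^G$ be the subspace of $G$-invariant elements. **Theorem.** Suppose that $0\notin S$, that the origin is a critical point of $\phi$, and that $\mathcal H_2^G=0$. Then: 1. the Hessian of $\phi$ at the origin vanishes; 2. the circle $\pi^{-1}(0)$, traversed once at constant speed, is a closed geodesic of $(X,g)$ which is stable to second order; 3. this geodesic is not stable; in fact every neighbourhood of the origin contains a point $x\notin S$ such that $\ell(\pi^{-1}(x))<\ell(\pi^{-1}(0))$. -/

import Mathlib

open scoped ContDiff

noncomputable section

namespace GibbonsHawking

/-! ### Riemannian geometry in a coordinate patch of `ℝⁿ` -/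

section Coordinates

variable {n : ℕ}

/-- The partial derivative `∂ᵢ f` at `y`. -/
def partialD (i : Fin n) (f : (Fin n → ℝ) → ℝ) (y : Fin n → ℝ) : ℝ :=
  fderiv ℝ f y (Pi.single i 1)

/-- The Christoffel symbols `Γˡᵢⱼ` of the metric `g = (gᵢⱼ)`:
`Γˡᵢⱼ = ½ ∑ₖ gˡᵏ (∂ᵢ gⱼₖ + ∂ⱼ gᵢₖ - ∂ₖ gᵢⱼ)`. -/
def christoffel (g : (Fin n → ℝ) → Matrix (Fin n) (Fin n) ℝ) (l i j : Fin n)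
    (y : Fin n → ℝ) : ℝ :=
  (1 / 2 : ℝ) * ∑ k, (g y)⁻¹ l k *
    (partialD i (fun z => g z j k) y + partialD j (fun z => g z i k) y
      - partialD k (fun z => g z i j) y)

/-- The vector `Γ(u, v)` with components `∑ᵢⱼ Γˡᵢⱼ uᵢ vⱼ`. -/
def christoffelVec (g : (Fin n → ℝ) → Matrix (Fin n) (Fin n) ℝ) (y u v : Fin n → ℝ) :
    Fin n → ℝ :=
  fun l => ∑ i, ∑ j, christoffel g l i j y * u i * v j

/-- The coefficient `Rˡ` of `R(∂ᵢ, ∂ⱼ) ∂ₖ`, for the convention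
`R(X, Y) Z = ∇_X ∇_Y Z - ∇_Y ∇_X Z - ∇_[X,Y] Z`. -/
def riemannCoeff (g : (Fin n → ℝ) → Matrix (Fin n) (Fin n) ℝ) (l i j k : Fin n)
    (y : Fin n → ℝ) : ℝ :=
  partialD i (christoffel g l j k) y - partialD j (christoffel g l i k) y
    + ∑ q, (christoffel g l i q y * christoffel g q j k y
      - christoffel g l j q y * christoffel g q i k y)

/-- The vector `R(u, v) w`. -/
def riemannVec (g : (Fin n → ℝ) → Matrix (Fin n) (Fin n) ℝ) (y u v w : Fin n → ℝ) :
    Fin n → ℝ :=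
  fun l => ∑ i, ∑ j, ∑ k, riemannCoeff g l i j k y * u i * v j * w k

end Coordinates

/-! ### The potential and its symmetries -/

/-- Euclidean three-space. -/
abbrev E3 : Type := EuclideanSpace ℝ (Fin 3)

/-- The potential `φ(x) = m + ∑_{p ∈ S} 1 / (2 |x - p|)`. -/
def potential (m : ℝ) (S : Finset E3) (x : E3) : ℝ :=
  m + ∑ p ∈ S, 1 / (2 * ‖x - p‖)

/-- The group `G ⊆ O(3)` of linear isometries that map the set `S` onto itself. -/
def symmetryGroup (S : Finset E3) : Subgroup (E3 ≃ₗᵢ[ℝ] E3) where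
  carrier := {A | A '' (S : Set E3) = S}
  one_mem' := by
    show (fun x : E3 => x) '' (S : Set E3) = S
    simp
  mul_mem' := by
    intro A B hA hB
    have hA' : A '' (S : Set E3) = S := hA
    have hB' : B '' (S : Set E3) = S := hB
    show (fun x => A (B x)) '' (S : Set E3) = S
    rw [← Set.image_image, hB', hA']
  inv_mem' := by
    intro A hA
    have hA' : A '' (S : Set E3) = S := hA
    show A.symm '' (S : Set E3) = S
    conv_lhs => rw [← hA']
    rw [Set.image_image]
    simp

/-- Precomposition of a polynomial in the coordinates of `ℝ³` with a linear isometry `A`: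
the `i`-th variable is replaced by the linear form `x ↦ (A x)ᵢ`. -/
def precomp (A : E3 ≃ₗᵢ[ℝ] E3) : MvPolynomial (Fin 3) ℝ →ₐ[ℝ] MvPolynomial (Fin 3) ℝ :=
  MvPolynomial.bind₁ fun i =>
    ∑ j, MvPolynomial.C (A (EuclideanSpace.single j 1) i) * MvPolynomial.X j

/-- The Laplacian on polynomials. -/
def polyLaplacian : MvPolynomial (Fin 3) ℝ →ₗ[ℝ] MvPolynomial (Fin 3) ℝ :=
  ∑ i, (MvPolynomial.pderiv i).toLinearMap ∘ₗ (MvPolynomial.pderiv i).toLinearMap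

/-- The space `H₂` of harmonic homogeneous polynomials of degree two. -/
def harmonicQuadratics : Submodule ℝ (MvPolynomial (Fin 3) ℝ) :=
  MvPolynomial.homogeneousSubmodule (Fin 3) ℝ 2 ⊓ LinearMap.ker polyLaplacian

/-- The subspace `H₂ᴳ` of the elements of `H₂` invariant under a group `G` of isometries. -/
def invariantHarmonicQuadratics (G : Subgroup (E3 ≃ₗᵢ[ℝ] E3)) :
    Submodule ℝ (MvPolynomial (Fin 3) ℝ) :=
  harmonicQuadratics ⊓
    ⨅ A ∈ G, LinearMap.eqLocus (precomp A).toLinearMap LinearMap.id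

/-! ### The circle bundle

The bundle is glued from trivial bundles by means of the Dirac monopole potentials.  A gauge `s`
selects for every `p ∈ S` a sign `±`; its domain is the complement of the half-lines
`p ∓ [0, ∞) e₃`, where the potential in this gauge is singular. -/

/-- The punctured space `ℝ³ ∖ S`. -/
abbrev Base (S : Finset E3) : Type := {x : E3 // x ∉ S}

/-- Gauges (only the values on `S` matter); `true` stands for `+`, `false` for `-`. -/
abbrev Gauge : Type := E3 → Bool

/-- The sign `±1`. -/
def sgn (b : Bool) : ℝ := if b then 1 else -1

/-- The domain of a gauge in `ℝ³`. -/
def gaugeDomain (S : Finset E3) (s : Gauge) : Set E3 :=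
  {x | ∀ p ∈ S, 0 < ‖x - p‖ + sgn (s p) * (x 2 - p 2)}

/-- The connection potential in the gauge `s`, by its components: the sum over `p ∈ S` of
`± (x₁ dx₂ - x₂ dx₁) / (2 r (r ± x₃))`, in coordinates centred at `p`, with `r = |x|`.
The connection form is `η = dθ + A`, and `dA = - ⋆ dφ`. -/
def gaugePotential (S : Finset E3) (s : Gauge) (x : E3) : Fin 3 → ℝ :=
  ∑ p ∈ S, (sgn (s p) / (2 * ‖x - p‖ * (‖x - p‖ + sgn (s p) * (x 2 - p 2)))) •
    ![-(x 1 - p 1), x 0 - p 0, 0]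

/-- The phase `e^{iα}` of the angle `α` of `x` around the vertical axis through `p`. -/
def azimuth (p x : E3) : Circle :=
  Circle.exp (Complex.arg ⟨x 0 - p 0, x 1 - p 1⟩)

/-- The transition function from the gauge `s` to the gauge `t`: the product of the azimuths about
those `p` where `s` is `+` and `t` is `-`, and of the inverse azimuths in the opposite case. -/
def transition (S : Finset E3) (s t : Gauge) (x : E3) : Circle :=
  ∏ p ∈ S, azimuth p x ^ (((s p).toNat : ℤ) - ((t p).toNat : ℤ))

lemma continuousAt_azimuth {p x : E3}
    (h : (⟨x 0 - p 0, x 1 - p 1⟩ : ℂ) ≠ 0) : ContinuousAt (azimuth p) x := by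
  have hc : Continuous fun y : E3 => (⟨y 0 - p 0, y 1 - p 1⟩ : ℂ) := by
    have : (fun y : E3 => (⟨y 0 - p 0, y 1 - p 1⟩ : ℂ)) =
        fun y : E3 => ((y 0 - p 0 : ℝ) : ℂ) + ((y 1 - p 1 : ℝ) : ℂ) * Complex.I := by
      funext y
      apply Complex.ext <;> simp
    rw [this]
    fun_prop
  have hne : ∀ᶠ y in nhds x, (⟨y 0 - p 0, y 1 - p 1⟩ : ℂ) ≠ 0 :=
    hc.continuousAt.eventually_ne h
  have hi : Topology.IsInducing (fun z : Circle => (z : ℂ)) := ⟨rfl⟩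
  rw [hi.continuousAt_iff]
  have key : ContinuousAt (fun y : E3 => (⟨y 0 - p 0, y 1 - p 1⟩ : ℂ) /
      (‖(⟨y 0 - p 0, y 1 - p 1⟩ : ℂ)‖ : ℂ)) x := by
    refine hc.continuousAt.div ?_ ?_
    · exact (Complex.continuous_ofReal.comp hc.norm).continuousAt
    · simpa using h
  refine key.congr ?_
  filter_upwards [hne] with y hy
  have h1 := Complex.norm_mul_exp_arg_mul_I (⟨y 0 - p 0, y 1 - p 1⟩ : ℂ)
  have h2 : (‖(⟨y 0 - p 0, y 1 - p 1⟩ : ℂ)‖ : ℂ) ≠ 0 := by simpa using hy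
  rw [div_eq_iff h2]
  conv_lhs => rw [← h1]
  rw [mul_comm]
  simp [azimuth, Circle.coe_exp]

lemma off_axis {p x : E3} {b c : Bool} (hbc : b ≠ c)
    (hb : 0 < ‖x - p‖ + sgn b * (x 2 - p 2)) (hc : 0 < ‖x - p‖ + sgn c * (x 2 - p 2)) :
    (⟨x 0 - p 0, x 1 - p 1⟩ : ℂ) ≠ 0 := by
  intro h
  have h0 : x 0 - p 0 = 0 := congrArg Complex.re h
  have h1 : x 1 - p 1 = 0 := congrArg Complex.im h
  have hn : ‖x - p‖ = |x 2 - p 2| := by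
    rw [EuclideanSpace.norm_eq]
    simp [Fin.sum_univ_three, h0, h1, Real.sqrt_sq_eq_abs]
  rw [hn] at hb hc
  cases b <;> cases c <;> simp [sgn] at hbc hb hc
  all_goals
    rcases abs_cases (x 2 - p 2) with ⟨h2, _⟩ | ⟨h2, _⟩ <;> rw [h2] at hb hc <;> linarith

/-- The principal circle bundle over `ℝ³ ∖ S` glued by the transition functions. -/
def bundleCore (S : Finset E3) : FiberBundleCore Gauge (Base S) Circle where
  baseSet s := {b | (b : E3) ∈ gaugeDomain S s}
  isOpen_baseSet s := by
    have : {b : Base S | (b : E3) ∈ gaugeDomain S s} = ⋂ p ∈ S,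
        {b : Base S | 0 < ‖(b : E3) - p‖ + sgn (s p) * ((b : E3) 2 - p 2)} := by
      ext b
      simp [gaugeDomain]
    rw [this]
    refine isOpen_biInter_finset fun p _ => isOpen_lt continuous_const ?_
    fun_prop
  indexAt b := fun p => decide (p 2 ≤ (b : E3) 2)
  mem_baseSet_at b := by
    intro p hp
    have hpos : 0 < ‖(b : E3) - p‖ := by
      rw [norm_pos_iff, sub_ne_zero]
      rintro h
      exact b.2 (h ▸ hp)
    by_cases h : p 2 ≤ (b : E3) 2
    · simp only [h, decide_true, sgn, if_true]
      linarith
    · simp only [h, decide_false, sgn]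
      push Not at h
      simp
      linarith
  coordChange s t b u := transition S s t b * u
  coordChange_self s b _ u := by simp [transition]
  continuousOn_coordChange s t := by
    refine ContinuousOn.mul ?_ continuousOn_snd
    intro q hq
    refine ContinuousAt.continuousWithinAt ?_
    have hs : (q.1 : E3) ∈ gaugeDomain S s := hq.1.1
    have ht : (q.1 : E3) ∈ gaugeDomain S t := hq.1.2
    have hval : ContinuousAt (fun q : Base S × Circle => (q.1 : E3)) q :=
      (continuous_subtype_val.comp continuous_fst).continuousAt
    have : ContinuousAt (transition S s t) (q.1 : E3) := by
      refine tendsto_finsetProd _ fun p hp => ?_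
      by_cases hst : s p = t p
      · simp only [hst, sub_self, zpow_zero]
        exact tendsto_const_nhds
      · exact (continuousAt_azimuth (off_axis hst (hs p hp) (ht p hp))).zpow _
    exact ContinuousAt.comp (f := fun q : Base S × Circle => (q.1 : E3)) this hval
  coordChange_comp s t w b _ u := by
    rw [← mul_assoc]
    congr 1
    simp only [transition]
    rw [← Finset.prod_mul_distrib]
    refine Finset.prod_congr rfl fun p _ => ?_
    rw [← zpow_add]
    congr 1
    ring

/-- The Gibbons–Hawking space over `ℝ³ ∖ S`, the total space of the circle bundle. -/
abbrev Space (S : Finset E3) : Type := (bundleCore S).TotalSpace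

variable {S : Finset E3}

/-- The projection `π` to `ℝ³`. -/
def proj (P : Space S) : E3 := (P.proj : E3)

/-- The preferred gauge at a point; its domain contains the projection of the point. -/
def gaugeAt (P : Space S) : Gauge := (bundleCore S).indexAt P.proj

/-- The fibre coordinate `e^{iθ}` of a point in the gauge `s`. -/
def fiberCoord (s : Gauge) (P : Space S) : Circle := ((bundleCore S).localTriv s P).2

/-- The coordinates `(θ, μ₁, μ₂, μ₃)` of a point in the gauge `s`. -/
def coords (s : Gauge) (P : Space S) : Fin 4 → ℝ :=
  Fin.cons (Complex.arg (fiberCoord s P)) fun i => proj P i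

/-! ### Tangent vectors and the metric

The coframe `(η, dμ₁, dμ₂, dμ₃)` trivialises the tangent bundle globally, and a tangent vector
`v` is recorded by its components `(η(v), dμ₁(v), dμ₂(v), dμ₃(v))`. -/

/-- Components in the coframe of the vector with components `v` with respect to the coordinates
`(θ, μ₁, μ₂, μ₃)` of the gauge `s`, at a point above `x`; this uses `η = dθ + A`. -/
def toFrame (S : Finset E3) (s : Gauge) (x : E3) (v : Fin 4 → ℝ) : Fin 4 → ℝ :=
  Fin.cons (v 0 + ∑ i, gaugePotential S s x i * v i.succ) fun i => v i.succ

/-- The inverse of `toFrame`. -/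
def toCoord (S : Finset E3) (s : Gauge) (x : E3) (v : Fin 4 → ℝ) : Fin 4 → ℝ :=
  Fin.cons (v 0 - ∑ i, gaugePotential S s x i * v i.succ) fun i => v i.succ

/-- The metric `g = φ⁻¹ η² + φ (dμ₁² + dμ₂² + dμ₃²)` at a point above `x`. -/
def metric (m : ℝ) (S : Finset E3) (x : E3) (v w : Fin 4 → ℝ) : ℝ :=
  (potential m S x)⁻¹ * (v 0 * w 0) + potential m S x * ∑ i : Fin 3, v i.succ * w i.succ

/-- The matrix of `g` in the coordinates `(θ, μ₁, μ₂, μ₃)` of the gauge `s`. -/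
def metricMatrix (m : ℝ) (S : Finset E3) (s : Gauge) (y : Fin 4 → ℝ) :
    Matrix (Fin 4) (Fin 4) ℝ :=
  let x : E3 := WithLp.toLp 2 fun i => y i.succ
  Matrix.of fun i j =>
    metric m S x (toFrame S s x (Pi.single i 1)) (toFrame S s x (Pi.single j 1))

/-! ### Loops -/

/-- A smooth loop in the Gibbons–Hawking space, as a `2π`-periodic map on `ℝ`. -/
def IsSmoothLoop (γ : ℝ → Space S) : Prop :=
  Function.Periodic γ (2 * Real.pi) ∧
  ContDiff ℝ ∞ (fun t => proj (γ t)) ∧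
  ∀ (s : Gauge) (t : ℝ), proj (γ t) ∈ gaugeDomain S s →
    ContDiffAt ℝ ∞ (fun r => (fiberCoord s (γ r) : ℂ)) t

/-- The velocity `(θ', μ₁', μ₂', μ₃')` of a curve in the coordinates of the gauge `s`; here
`θ' = Im (u' / u)` for the fibre coordinate `u = e^{iθ}`. -/
def coordVelocity (s : Gauge) (γ : ℝ → Space S) (t : ℝ) : Fin 4 → ℝ :=
  Fin.cons (deriv (fun r => (fiberCoord s (γ r) : ℂ)) t / (fiberCoord s (γ t) : ℂ)).im
    fun i => deriv (fun r => proj (γ r) i) t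

/-- The velocity of a curve, by its components in the coframe. -/
def velocity (γ : ℝ → Space S) (t : ℝ) : Fin 4 → ℝ :=
  toFrame S (gaugeAt (γ t)) (proj (γ t)) (coordVelocity (gaugeAt (γ t)) γ t)

/-- The length of a loop. -/
def length (m : ℝ) (γ : ℝ → Space S) : ℝ :=
  ∫ t in (0 : ℝ)..(2 * Real.pi),
    Real.sqrt (metric m S (proj (γ t)) (velocity γ t) (velocity γ t))

/-- The Levi-Civita covariant derivative `DV/dt` of a vector field `V` along a curve; it is computed
in the coordinates of the preferred gauge `s` at `γ t`. -/
def covDeriv (m : ℝ) (γ : ℝ → Space S) (V : ℝ → Fin 4 → ℝ) (t : ℝ) : Fin 4 → ℝ :=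
  let s := gaugeAt (γ t)
  toFrame S s (proj (γ t))
    (deriv (fun r => toCoord S s (proj (γ r)) (V r)) t +
      christoffelVec (metricMatrix m S s) (coords s (γ t)) (coordVelocity s γ t)
        (toCoord S s (proj (γ t)) (V t)))

/-- The curvature `R(u, v) w` at a point, for vectors given by their components in the coframe. -/
def curvature (m : ℝ) (P : Space S) (u v w : Fin 4 → ℝ) : Fin 4 → ℝ :=
  let s := gaugeAt P
  toFrame S s (proj P)
    (riemannVec (metricMatrix m S s) (coords s P) (toCoord S s (proj P) u)
      (toCoord S s (proj P) v) (toCoord S s (proj P) w))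

/-- A closed geodesic: a smooth loop with nowhere vanishing velocity and `Dγ'/dt = 0`. -/
def IsClosedGeodesic (m : ℝ) (γ : ℝ → Space S) : Prop :=
  IsSmoothLoop γ ∧ (∀ t, velocity γ t ≠ 0) ∧ ∀ t, covDeriv m γ (velocity γ) t = 0

/-- The smooth periodic normal vector fields along a loop. -/
def normalFields (m : ℝ) (γ : ℝ → Space S) : Submodule ℝ (ℝ → Fin 4 → ℝ) where
  carrier := {V | ContDiff ℝ ∞ V ∧ Function.Periodic V (2 * Real.pi) ∧
    ∀ t, metric m S (proj (γ t)) (velocity γ t) (V t) = 0}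
  zero_mem' := ⟨contDiff_const, fun _ => rfl, fun t => by simp [metric]⟩
  add_mem' := by
    rintro V W ⟨hV, hV', hV''⟩ ⟨hW, hW', hW''⟩
    refine ⟨hV.add hW, hV'.add hW', fun t => ?_⟩
    have h := congrArg₂ (· + ·) (hV'' t) (hW'' t)
    simp only [metric, Fin.sum_univ_three, add_zero] at h
    simp only [metric, Fin.sum_univ_three, Pi.add_apply]
    linarith
  smul_mem' := by
    rintro c V ⟨hV, hV', hV''⟩
    refine ⟨contDiff_const.smul hV, fun t => ?_, fun t => ?_⟩
    · simp only [Pi.smul_apply, hV' t]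
    · have h := congrArg (c * ·) (hV'' t)
      simp only [metric, Fin.sum_univ_three, mul_zero] at h
      simp only [metric, Fin.sum_univ_three, Pi.smul_apply, smul_eq_mul]
      linarith

/-- The Jacobi operator `J V = D²V/dt² - R(γ', V) γ'`. -/
def jacobi (m : ℝ) (γ : ℝ → Space S) (V : ℝ → Fin 4 → ℝ) (t : ℝ) : Fin 4 → ℝ :=
  covDeriv m γ (covDeriv m γ V) t - curvature m (γ t) (velocity γ t) (V t) (velocity γ t)

/-- The quadratic form `- ∫ g(V, J V) dt` of `-J`. -/
def indexForm (m : ℝ) (γ : ℝ → Space S) (V : ℝ → Fin 4 → ℝ) : ℝ :=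
  -∫ t in (0 : ℝ)..(2 * Real.pi), metric m S (proj (γ t)) (V t) (jacobi m γ V t)

/-- The index of a loop: the largest dimension of a space of normal fields on which `-J` is
negative definite. -/
def index (m : ℝ) (γ : ℝ → Space S) : ℕ∞ :=
  ⨆ W ∈ {W : Submodule ℝ (ℝ → Fin 4 → ℝ) | W ≤ normalFields m γ ∧
    ∀ V ∈ W, V ≠ 0 → indexForm m γ V < 0}, Cardinal.toENat (Module.rank ℝ W)

/-- Stability to second order: a closed geodesic of index zero. -/
def IsStableToSecondOrder (m : ℝ) (γ : ℝ → Space S) : Prop :=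
  IsClosedGeodesic m γ ∧ index m γ = 0

/-- Stability: `γ` is a local minimum of the length among smooth loops.  Neighbourhoods of `γ` are
those of the `C¹` topology: the position and the velocity at each time `t` are prescribed up to an
open condition `U` (which may depend on `t`). -/
def IsStable (m : ℝ) (γ : ℝ → Space S) : Prop :=
  ∃ U : Set (ℝ × Space S × (Fin 4 → ℝ)), IsOpen U ∧
    (∀ t ∈ Set.Icc 0 (2 * Real.pi), (t, γ t, velocity γ t) ∈ U) ∧
    ∀ σ : ℝ → Space S, IsSmoothLoop σ →
      (∀ t ∈ Set.Icc 0 (2 * Real.pi), (t, σ t, velocity σ t) ∈ U) →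
      length m γ ≤ length m σ

/-- The circle `π⁻¹(b)` above a point of `ℝ³ ∖ S`, run through once, with `θ' = 1`. -/
def fiberLoop (b : Base S) (t : ℝ) : Space S := ⟨b, Circle.exp t⟩

end GibbonsHawking

end

/-!
The circle `π⁻¹(x)` has length `2π φ(x)^{-1/2}` and is shorter where `φ` is larger, so the
behaviour of `φ` near the origin decides whether the circle above it minimises the length.

The Hessian. The group `G` preserves `φ`, so the Hessian of `φ` at the origin is a `G`-invariant
symmetric form, and it is trace-free because `φ` is harmonic. Its quadratic polynomial lies in
`H₂ᴳ = 0`, hence the Hessian vanishes (`hessian_potential_eq_zero`).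

Second-order stability. Let `dφ` vanish at `x`. Then `dη = - ⋆ dφ` vanishes above `x`
(`curl_gaugePotential_eq_zero`), hence so does `d(φ⁻¹ η)`. This is the exterior derivative of the
dual form of the Killing field `∂_θ`, so `∂_θ` is parallel at the points above `x`, which says
`Γˡ₀ⱼ = 0` (`christoffel_zero_left`). Consequently the circle is a geodesic and covariant
differentiation along it is the ordinary derivative of components in the coframe. Nothing depends
on `θ`, so the only derivative of a Christoffel symbol that enters `R(∂_θ, V) ∂_θ` is that of
`Γˡ₀₀`, a combination of the derivatives of `φ⁻¹`; it is zero when the Hessian vanishes too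
(`riemannCoeff_vertical`). So the Jacobi operator is `V ↦ V''`, the index form is
`∫ g(V', V') dt ≥ 0`, and the index is `0` (`index_circleLoop`).

Instability. The harmonic function `φ` has no local maximum (`not_isLocalMax_potential`): by the
strong maximum principle, proved through Hopf's boundary point lemma, it would be constant near
such a point, hence constant on the connected set `ℝ³ ∖ S` by analyticity, whereas it is unbounded
near each point of `S`. So there are points `x` arbitrarily near the origin with `φ(x) > φ(0)`, over
which the circles are shorter; suitably parametrised they are `C¹` close to the circle over the
origin (`eventually_exists_circleLoop_mem`).
-/

namespace GibbonsHawking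

/-! ### Second derivatives -/

section SecondDerivative

open Filter Topology

variable {E : Type*} [NormedAddCommGroup E]

/-- At a local maximum the Hessian is negative semidefinite. -/
lemma hessian_nonpos_of_isLocalMax [NormedSpace ℝ E] {f : E → ℝ} {x : E}
    (hf : ContDiffAt ℝ 2 f x) (hmax : IsLocalMax f x) (v : E) :
    fderiv ℝ (fderiv ℝ f) x v v ≤ 0 := by
  by_contra! hpos
  have hline : ∀ t : ℝ, HasDerivAt (fun t : ℝ => x + t • v) v t := fun t => by
    simpa using ((hasDerivAt_id t).smul_const v).const_add x
  have hcont : ContinuousAt (fun t : ℝ => x + t • v) 0 := (hline 0).continuousAt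
  have hcont' : Tendsto (fun t : ℝ => x + t • v) (𝓝 0) (𝓝 x) := by
    simpa [ContinuousAt] using hcont
  have hdiff : ∀ᶠ y in 𝓝 x, DifferentiableAt ℝ f y :=
    (hf.eventually (by simp)).mono fun y hy => hy.differentiableAt (by simp)
  have hd1 : deriv (fun t : ℝ => f (x + t • v)) =ᶠ[𝓝 0] fun t => fderiv ℝ f (x + t • v) v := by
    filter_upwards [hcont'.eventually hdiff] with t ht
    exact (ht.hasFDerivAt.comp_hasDerivAt t (hline t)).deriv
  have hf2 : HasFDerivAt (fderiv ℝ f) (fderiv ℝ (fderiv ℝ f) x) (x + (0 : ℝ) • v) := by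
    rw [zero_smul, add_zero]
    exact ((hf.fderiv_right (m := 1) (by norm_num)).differentiableAt (by simp)).hasFDerivAt
  have hd2 : deriv (deriv fun t : ℝ => f (x + t • v)) 0 = fderiv ℝ (fderiv ℝ f) x v v := by
    rw [hd1.deriv_eq]
    have h1 : HasDerivAt (fun t : ℝ => fderiv ℝ f (x + t • v)) (fderiv ℝ (fderiv ℝ f) x v) 0 :=
      hf2.comp_hasDerivAt 0 (hline 0)
    have h2 := ((ContinuousLinearMap.apply ℝ ℝ v).hasFDerivAt
      (x := fderiv ℝ f (x + (0 : ℝ) • v))).comp_hasDerivAt (0 : ℝ) h1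
    exact h2.deriv
  have hmaxline : IsLocalMax (fun t : ℝ => f (x + t • v)) 0 := by
    have := hcont'.eventually hmax
    filter_upwards [this] with t ht
    simpa using ht
  have hmin : IsLocalMin (fun t : ℝ => f (x + t • v)) 0 := by
    refine isLocalMin_of_deriv_deriv_pos (by rw [hd2]; exact hpos) hmaxline.deriv_eq_zero ?_
    have : ContinuousAt f (x + (0 : ℝ) • v) := by simpa using hf.continuousAt
    exact this.comp (f := fun t : ℝ => x + t • v) hcont
  have hconst : (fun t : ℝ => f (x + t • v)) =ᶠ[𝓝 0] fun _ => f x := by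
    filter_upwards [hmaxline, hmin] with t h1 h2
    simp only [zero_smul, add_zero] at h1 h2
    exact le_antisymm h1 h2
  have hz : deriv (deriv fun t : ℝ => f (x + t • v)) 0 = 0 := by
    rw [hconst.deriv.deriv_eq]
    simp
  rw [hd2] at hz
  exact hpos.ne' hz

/-- If `h` vanishes at `y` together with its derivative, then so does the product with any function
continuous at `y`; no differentiability of that function is needed. -/
lemma hasFDerivAt_mul_zero [NormedSpace ℝ E] {f h : E → ℝ} {y : E} (hf : ContinuousAt f y)
    (hh : HasFDerivAt h (0 : E →L[ℝ] ℝ) y) (h0 : h y = 0) :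
    HasFDerivAt (fun z => f z * h z) (0 : E →L[ℝ] ℝ) y := by
  have hO : f =O[𝓝 y] fun _ => (1 : ℝ) := hf.isBigO_one ℝ
  have ho : (fun z => h z) =o[𝓝 y] fun z => z - y := by
    have := hh.isLittleO
    simpa [h0] using this
  have := hO.mul_isLittleO ho.norm_right
  refine HasFDerivAt.of_isLittleO ?_
  simpa [h0] using this.norm_right

variable [InnerProductSpace ℝ E] {p x : E} (a : ℝ)

lemma hasFDerivAt_normSq_rpow (h : x ≠ p) :
    HasFDerivAt (fun y => (‖y - p‖ ^ 2) ^ a)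
      ((2 * a * (‖x - p‖ ^ 2) ^ (a - 1)) • innerSL ℝ (x - p)) x := by
  have hne : ‖x - p‖ ^ 2 ≠ 0 := by simpa [sub_eq_zero] using h
  have h1 := (((hasFDerivAt_id x).sub_const p).norm_sq).rpow_const (p := a) (Or.inl hne)
  refine h1.congr_fderiv ?_
  ext v
  simp
  ring

lemma hessian_normSq_rpow (h : x ≠ p) (v : E) :
    fderiv ℝ (fderiv ℝ fun y => (‖y - p‖ ^ 2) ^ a) x v v =
      4 * a * (a - 1) * (‖x - p‖ ^ 2) ^ (a - 2) * inner ℝ (x - p) v ^ 2 +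
        2 * a * (‖x - p‖ ^ 2) ^ (a - 1) * ‖v‖ ^ 2 := by
  have hev : fderiv ℝ (fun y => (‖y - p‖ ^ 2) ^ a) =ᶠ[𝓝 x]
      fun y => (2 * a * (‖y - p‖ ^ 2) ^ (a - 1)) • innerSL ℝ (y - p) := by
    filter_upwards [isOpen_ne.mem_nhds h] with y hy
    exact (hasFDerivAt_normSq_rpow a hy).fderiv
  rw [hev.fderiv_eq]
  have h1 := ((hasFDerivAt_normSq_rpow (a - 1) h).const_mul (2 * a)).smul
    ((innerSL ℝ (E := E)).hasFDerivAt.comp x ((hasFDerivAt_id x).sub_const p))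
  have h2 : fderiv ℝ (fun y => (2 * a * (‖y - p‖ ^ 2) ^ (a - 1)) • innerSL ℝ (y - p)) x = _ :=
    h1.fderiv
  rw [h2, show a - 1 - 1 = a - 2 by ring]
  have h3 : ((innerSL ℝ ∘SL ContinuousLinearMap.id ℝ E) v) v = ‖v‖ ^ 2 :=
    real_inner_self_eq_norm_sq v
  have h4 : innerSL ℝ (x - p) v = inner ℝ (x - p) v := rfl
  simp only [add_apply, smul_apply, smul_eq_mul, h3, h4,
    ContinuousLinearMap.smulRight_apply, Function.comp_apply, id_eq]
  ring

end SecondDerivative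

/-- The trace of the Hessian. -/
noncomputable def hessianTrace (f : E3 → ℝ) (x : E3) : ℝ :=
  ∑ i : Fin 3, fderiv ℝ (fderiv ℝ f) x (EuclideanSpace.single i 1) (EuclideanSpace.single i 1)

/-- In dimension three, `Δ r²ᵃ = 2a (2a + 1) r²ᵃ⁻²`; this vanishes for `a = -1/2` and is positive
for `a = -1`. -/
lemma hessianTrace_normSq_rpow {p x : E3} (a : ℝ) (h : x ≠ p) :
    hessianTrace (fun y => (‖y - p‖ ^ 2) ^ a) x =
      2 * a * (2 * a + 1) * (‖x - p‖ ^ 2) ^ (a - 1) := by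
  have hpos : 0 < ‖x - p‖ ^ 2 := by
    have : x - p ≠ 0 := sub_ne_zero.2 h
    positivity
  have hsq : (x - p) 0 ^ 2 + (x - p) 1 ^ 2 + (x - p) 2 ^ 2 = ‖x - p‖ ^ 2 := by
    rw [EuclideanSpace.norm_sq_eq]
    simp [Fin.sum_univ_three]
  have hpow : (‖x - p‖ ^ 2) ^ (a - 1) = (‖x - p‖ ^ 2) ^ (a - 2) * ‖x - p‖ ^ 2 := by
    conv_lhs => rw [show a - 1 = (a - 2) + 1 by ring, Real.rpow_add_one hpos.ne']
  simp only [hessianTrace, hessian_normSq_rpow a h, Fin.sum_univ_three,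
    EuclideanSpace.inner_single_right, PiLp.norm_single]
  rw [hpow]
  generalize (‖x - p‖ ^ 2) ^ (a - 2) = c at *
  rw [← hsq]
  simp
  ring

lemma contDiffAt_normSq_rpow {n : WithTop ℕ∞} {p x : E3} (a : ℝ) (h : x ≠ p) :
    ContDiffAt ℝ n (fun y => (‖y - p‖ ^ 2) ^ a) x := by
  have hne : ‖x - p‖ ^ 2 ≠ 0 := by simpa [sub_eq_zero] using h
  have h1 : ContDiffAt ℝ n (fun y : E3 => ‖y - p‖ ^ 2) x :=
    (contDiff_norm_sq ℝ).contDiffAt.comp x (contDiffAt_id.sub contDiffAt_const)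
  exact h1.rpow_const_of_ne hne

lemma hessian_add {f g : E3 → ℝ} {x : E3} (hf : ContDiffAt ℝ 2 f x) (hg : ContDiffAt ℝ 2 g x) :
    fderiv ℝ (fderiv ℝ (f + g)) x = fderiv ℝ (fderiv ℝ f) x + fderiv ℝ (fderiv ℝ g) x := by
  have h1 : fderiv ℝ (f + g) =ᶠ[nhds x] fderiv ℝ f + fderiv ℝ g := by
    filter_upwards [hf.eventually (by simp), hg.eventually (by simp)] with y h1 h2
    exact fderiv_add (h1.differentiableAt (by simp)) (h2.differentiableAt (by simp))
  rw [h1.fderiv_eq]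
  exact fderiv_add ((hf.fderiv_right (m := 1) (by norm_num)).differentiableAt (by simp))
    ((hg.fderiv_right (m := 1) (by norm_num)).differentiableAt (by simp))

lemma hessianTrace_add {f g : E3 → ℝ} {x : E3} (hf : ContDiffAt ℝ 2 f x)
    (hg : ContDiffAt ℝ 2 g x) :
    hessianTrace (f + g) x = hessianTrace f x + hessianTrace g x := by
  simp [hessianTrace, hessian_add hf hg, Finset.sum_add_distrib]

lemma hessianTrace_const_smul (c : ℝ) (f : E3 → ℝ) (x : E3) :
    hessianTrace (c • f) x = c * hessianTrace f x := by
  have h1 : fderiv ℝ (c • f) = c • fderiv ℝ f := fderiv_const_smul_field c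
  have h2 : fderiv ℝ (c • fderiv ℝ f) = c • fderiv ℝ (fderiv ℝ f) :=
    fderiv_const_smul_field (F := E3 →L[ℝ] ℝ) (f := fderiv ℝ f) c
  simp [hessianTrace, h1, h2, Finset.mul_sum]

/-! ### The potential -/

lemma potential_empty (m : ℝ) : potential m ∅ = fun _ => m := by
  funext x
  simp [potential]

lemma potential_insert (m : ℝ) {S : Finset E3} {p : E3} (hp : p ∉ S) :
    potential m (insert p S) =
      potential m S + (1 / 2 : ℝ) • fun y : E3 => (‖y - p‖ ^ 2) ^ (-(1 / 2) : ℝ) := by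
  funext x
  have h : (‖x - p‖ ^ 2) ^ (-(1 / 2) : ℝ) = ‖x - p‖⁻¹ := by
    rw [Real.rpow_neg (by positivity), ← Real.sqrt_eq_rpow, Real.sqrt_sq (norm_nonneg _)]
  simp only [potential, Finset.sum_insert hp, Pi.add_apply, Pi.smul_apply, h, smul_eq_mul]
  rw [one_div, mul_inv]
  ring

lemma contDiffAt_smul_normSq_rpow {n : WithTop ℕ∞} {p x : E3} (c a : ℝ) (h : x ≠ p) :
    ContDiffAt ℝ n (c • fun y : E3 => (‖y - p‖ ^ 2) ^ a) x :=
  contDiffAt_const.smul (contDiffAt_normSq_rpow a h)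

lemma contDiffAt_potential {n : WithTop ℕ∞} (m : ℝ) {S : Finset E3} {x : E3} (hx : x ∉ S) :
    ContDiffAt ℝ n (potential m S) x := by
  induction S using Finset.induction_on with
  | empty => rw [potential_empty]; exact contDiffAt_const
  | insert p S hp ih =>
    rw [Finset.mem_insert, not_or] at hx
    rw [potential_insert m hp]
    exact (ih hx.2).add (contDiffAt_smul_normSq_rpow _ _ hx.1)

/-- The potential is harmonic off `S`. -/
lemma hessianTrace_potential (m : ℝ) {S : Finset E3} {x : E3} (hx : x ∉ S) :
    hessianTrace (potential m S) x = 0 := by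
  induction S using Finset.induction_on with
  | empty => simp [potential_empty, hessianTrace]
  | insert p S hp ih =>
    rw [Finset.mem_insert, not_or] at hx
    rw [potential_insert m hp, hessianTrace_add (contDiffAt_potential m hx.2)
      (contDiffAt_smul_normSq_rpow _ _ hx.1), hessianTrace_const_smul,
      hessianTrace_normSq_rpow _ hx.1, ih hx.2]
    norm_num

lemma potential_pos {m : ℝ} (hm : 0 ≤ m) {S : Finset E3} (hS : S.Nonempty) {x : E3} (hx : x ∉ S) :
    0 < potential m S x := by
  refine add_pos_of_nonneg_of_pos hm (Finset.sum_pos (fun p hp => ?_) hS)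
  have : x - p ≠ 0 := sub_ne_zero.2 fun h => hx (h ▸ hp)
  positivity

/-! ### Vanishing of the Hessian -/

lemma potential_symmetry (m : ℝ) {S : Finset E3} {A : E3 ≃ₗᵢ[ℝ] E3} (hA : A ∈ symmetryGroup S)
    (x : E3) : potential m S (A x) = potential m S x := by
  classical
  have hA' : A '' (S : Set E3) = S := hA
  have himg : S.image A = S := by
    apply Finset.coe_injective
    rw [Finset.coe_image, hA']
  unfold potential
  congr 1
  conv_lhs => rw [← himg]
  rw [Finset.sum_image fun a _ b _ h => A.injective h]
  simp only [← map_sub, A.norm_map]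

lemma hessian_potential_symmetry (m : ℝ) {S : Finset E3} (h0 : (0 : E3) ∉ S) {A : E3 ≃ₗᵢ[ℝ] E3}
    (hA : A ∈ symmetryGroup S) (v w : E3) :
    fderiv ℝ (fderiv ℝ (potential m S)) 0 (A v) (A w) =
      fderiv ℝ (fderiv ℝ (potential m S)) 0 v w := by
  set f := potential m S with hf
  have hcomp : f ∘ A.toContinuousLinearEquiv = f := funext fun x => potential_symmetry m hA x
  have h1 : ∀ x, fderiv ℝ f x w = fderiv ℝ f (A x) (A w) := fun x => by
    conv_lhs => rw [← hcomp, ContinuousLinearEquiv.comp_right_fderiv]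
    rfl
  have hD : HasFDerivAt (fderiv ℝ f) (fderiv ℝ (fderiv ℝ f) 0) 0 :=
    (((contDiffAt_potential (n := 2) m h0).fderiv_right (m := 1) (by norm_num)).differentiableAt
      (by simp)).hasFDerivAt
  have happly : ∀ u : E3, HasFDerivAt (fun x => fderiv ℝ f x u)
      ((ContinuousLinearMap.apply ℝ ℝ u) ∘L fderiv ℝ (fderiv ℝ f) 0) 0 := fun u =>
    (ContinuousLinearMap.apply ℝ ℝ u).hasFDerivAt.comp 0 hD
  have h2 : HasFDerivAt (fun x => fderiv ℝ f (A x) (A w))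
      (((ContinuousLinearMap.apply ℝ ℝ (A w)) ∘L fderiv ℝ (fderiv ℝ f) 0) ∘L
        (A.toContinuousLinearEquiv : E3 →L[ℝ] E3)) 0 := by
    have hA0 : HasFDerivAt (fun x => A x) (A.toContinuousLinearEquiv : E3 →L[ℝ] E3) 0 :=
      (A.toContinuousLinearEquiv : E3 →L[ℝ] E3).hasFDerivAt
    have := happly (A w)
    rw [← map_zero A] at this
    have h3 := this.comp (0 : E3) hA0
    rw [map_zero A] at h3
    exact h3
  have h3 := (happly w).unique (h2.congr_of_eventuallyEq (Filter.Eventually.of_forall h1))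
  exact (congrArg (fun L : E3 →L[ℝ] ℝ => L v) h3).symm

/-- The quadratic polynomial of a bilinear form. -/
noncomputable def quadraticPoly (B : E3 →L[ℝ] E3 →L[ℝ] ℝ) : MvPolynomial (Fin 3) ℝ :=
  ∑ i, ∑ j, MvPolynomial.C (B (EuclideanSpace.single i 1) (EuclideanSpace.single j 1)) *
    (MvPolynomial.X i * MvPolynomial.X j)

lemma sum_smul_single (x : E3) : ∑ i, x i • EuclideanSpace.single i (1 : ℝ) = x := by
  ext j
  simp [Pi.single_apply]

lemma eval_quadraticPoly (B : E3 →L[ℝ] E3 →L[ℝ] ℝ) (x : E3) :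
    MvPolynomial.eval (fun i => x i) (quadraticPoly B) = B x x := by
  conv_rhs => rw [← sum_smul_single x]
  simp only [quadraticPoly, map_sum, map_mul, MvPolynomial.eval_C, MvPolynomial.eval_X, map_smul,
    sum_apply, smul_apply, smul_eq_mul, Finset.mul_sum]
  rw [Finset.sum_comm]
  refine Finset.sum_congr rfl fun i _ => Finset.sum_congr rfl fun j _ => ?_
  ring

lemma eval_precomp (A : E3 ≃ₗᵢ[ℝ] E3) (P : MvPolynomial (Fin 3) ℝ) (x : E3) :
    MvPolynomial.eval (fun i => x i) (precomp A P) = MvPolynomial.eval (fun i => A x i) P := by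
  have : MvPolynomial.eval (fun i => x i) (precomp A P) = MvPolynomial.eval
      (fun i => MvPolynomial.eval (fun i => x i) (∑ j, MvPolynomial.C
        (A (EuclideanSpace.single j 1) i) * MvPolynomial.X j)) P := by
    simp only [precomp, MvPolynomial.eval, MvPolynomial.eval₂Hom_bind₁]
  rw [this]
  congr 2
  funext i
  conv_rhs => rw [← sum_smul_single x]
  simp [mul_comm]

lemma quadraticPoly_mem_harmonicQuadratics {B : E3 →L[ℝ] E3 →L[ℝ] ℝ}
    (hB : ∑ i : Fin 3, B (EuclideanSpace.single i 1) (EuclideanSpace.single i 1) = 0) :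
    quadraticPoly B ∈ harmonicQuadratics := by
  refine ⟨?_, ?_⟩
  · rw [SetLike.mem_coe, MvPolynomial.mem_homogeneousSubmodule]
    refine MvPolynomial.IsHomogeneous.sum _ _ _ fun i _ =>
      MvPolynomial.IsHomogeneous.sum _ _ _ fun j _ => ?_
    simpa using (MvPolynomial.isHomogeneous_C (Fin 3) _).mul
      ((MvPolynomial.isHomogeneous_X ℝ i).mul (MvPolynomial.isHomogeneous_X ℝ j))
  · rw [SetLike.mem_coe, LinearMap.mem_ker]
    have : polyLaplacian (quadraticPoly B) = 2 * MvPolynomial.C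
        (∑ i : Fin 3, B (EuclideanSpace.single i 1) (EuclideanSpace.single i 1)) := by
      simp [polyLaplacian, quadraticPoly, Fin.sum_univ_three, MvPolynomial.pderiv_X]
      ring
    rw [this, hB]
    simp

/-- The Hessian at the origin is a trace-free symmetric form invariant under the symmetry group, so
its quadratic polynomial is an invariant harmonic quadratic. -/
lemma hessian_potential_eq_zero (m : ℝ) {S : Finset E3} (h0 : (0 : E3) ∉ S)
    (hG : invariantHarmonicQuadratics (symmetryGroup S) = ⊥) :
    fderiv ℝ (fderiv ℝ (potential m S)) 0 = 0 := by
  set B := fderiv ℝ (fderiv ℝ (potential m S)) 0 with hBdef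
  have hmem : quadraticPoly B ∈ invariantHarmonicQuadratics (symmetryGroup S) := by
    refine ⟨quadraticPoly_mem_harmonicQuadratics (hessianTrace_potential m h0), ?_⟩
    simp only [SetLike.mem_coe, Submodule.mem_iInf, LinearMap.mem_eqLocus, AlgHom.toLinearMap_apply,
      LinearMap.id_apply]
    intro A hA
    refine MvPolynomial.funext fun x => ?_
    have h1 := eval_precomp A (quadraticPoly B) (WithLp.toLp 2 x)
    have h2 := eval_quadraticPoly B (WithLp.toLp 2 x)
    rw [eval_quadraticPoly, hessian_potential_symmetry m h0 hA] at h1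
    exact h1.trans h2.symm
  rw [hG, Submodule.mem_bot] at hmem
  have hdiag : ∀ x, B x x = 0 := fun x => by
    rw [← eval_quadraticPoly, hmem, map_zero]
  have hsymm : ∀ v w, B v w = B w v := fun v w =>
    ((contDiffAt_potential (n := 2) m h0).isSymmSndFDerivAt (by simp)) v w
  ext v w
  have h := hdiag (v + w)
  simp only [map_add, add_apply, hdiag, hsymm w v] at h
  simp only [zero_apply]
  linarith

/-! ### The maximum principle -/

section MaximumPrinciple

open Filter Topology Metric

lemma hessianTrace_nonpos_of_isLocalMax {f : E3 → ℝ} {x : E3} (hf : ContDiffAt ℝ 2 f x)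
    (hmax : IsLocalMax f x) : hessianTrace f x ≤ 0 :=
  Finset.sum_nonpos fun _ _ => hessian_nonpos_of_isLocalMax hf hmax _

/-- Hopf's boundary point lemma. If a harmonic function is smaller than `M` inside a ball and equal
to `M` at a boundary point, then that point is not critical. The barrier is `r⁻²`, which is strictly
subharmonic in dimension three. -/
lemma fderiv_ne_zero_of_lt_on_ball {f : E3 → ℝ} {c z : E3} {M : ℝ} (hzc : z ≠ c)
    (hf : ∀ x ∈ closedBall c ‖z - c‖, ContDiffAt ℝ 2 f x)
    (hharm : ∀ x ∈ ball c ‖z - c‖, hessianTrace f x = 0)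
    (hlt : ∀ x ∈ ball c ‖z - c‖, f x < M) (hz : f z = M) : fderiv ℝ f z ≠ 0 := by
  set R := ‖z - c‖ with hR
  have hRpos : 0 < R := norm_pos_iff.2 (sub_ne_zero.2 hzc)
  have hle : ∀ x ∈ closedBall c R, f x ≤ M := by
    have hcl : closure (ball c R) = closedBall c R := closure_ball c hRpos.ne'
    intro x hx
    rw [← hcl] at hx
    have hcont : ContinuousOn f (closure (ball c R)) := fun y hy =>
      (hf y (hcl ▸ hy)).continuousAt.continuousWithinAt
    exact ContinuousWithinAt.closure_le hx ((hcont x hx).mono subset_closure)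
      continuousWithinAt_const fun y hy => (hlt y hy).le
  set b : E3 → ℝ := fun y => (‖y - c‖ ^ 2) ^ (-1 : ℝ) with hb
  have hbval : ∀ y, b y = (‖y - c‖ ^ 2)⁻¹ := fun y => Real.rpow_neg_one _
  -- On the inner sphere `f` stays away from `M`.
  obtain ⟨δ, hδ, hinner⟩ : ∃ δ > 0, ∀ x ∈ sphere c (R / 2), f x ≤ M - δ := by
    have hsub : sphere c (R / 2) ⊆ ball c R := fun x hx => by
      rw [mem_sphere] at hx
      rw [mem_ball, hx]
      linarith
    have hne : (sphere c (R / 2)).Nonempty := NormedSpace.sphere_nonempty.2 (by linarith)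
    obtain ⟨y, hy, hymax⟩ := (isCompact_sphere c (R / 2)).exists_isMaxOn hne (f := f)
      fun x hx => (hf x (ball_subset_closedBall (hsub hx))).continuousAt.continuousWithinAt
    exact ⟨M - f y, sub_pos.2 (hlt y (hsub hy)), fun x hx => by simpa using hymax hx⟩
  -- The weight keeps the barrier below `δ` on the inner sphere.
  set η := δ * R ^ 2 / 4 with hη
  have hηpos : 0 < η := by positivity
  set h : E3 → ℝ := f + η • b with hh
  set T := closedBall c R \ ball c (R / 2) with hT
  have hTne : ∀ x ∈ T, x ≠ c := fun x hx hxc =>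
    hx.2 (by rw [hxc]; exact mem_ball_self (by linarith))
  have hhdiff : ∀ x ∈ T, ContDiffAt ℝ 2 h x := fun x hx =>
    (hf x hx.1).add (contDiffAt_smul_normSq_rpow _ _ (hTne x hx))
  have hTcomp : IsCompact T := (isCompact_closedBall c R).diff isOpen_ball
  have hzT : z ∈ T := by
    refine ⟨by simp [dist_eq_norm, hR], ?_⟩
    rw [mem_ball, dist_eq_norm, ← hR]
    linarith
  have hbound : ∀ x ∈ T, h x ≤ M + η * (R ^ 2)⁻¹ := by
    obtain ⟨y, hy, hymax⟩ := hTcomp.exists_isMaxOn ⟨z, hzT⟩ (f := h)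
      fun x hx => (hhdiff x hx).continuousAt.continuousWithinAt
    suffices h y ≤ M + η * (R ^ 2)⁻¹ from fun x hx => (hymax hx).trans this
    have hy1 : ‖y - c‖ ≤ R := by simpa [dist_eq_norm] using hy.1
    have hy2 : R / 2 ≤ ‖y - c‖ := by simpa [dist_eq_norm] using hy.2
    have hval : h y = f y + η * (‖y - c‖ ^ 2)⁻¹ := by simp [hh, hbval]
    rcases hy1.eq_or_lt with h1 | h1
    · rw [hval, h1]
      linarith [hle y hy.1]
    rcases hy2.eq_or_lt with h2 | h2
    · have hfy := hinner y (by simp [h2])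
      rw [hval, ← h2]
      have e1 : η * ((R / 2) ^ 2)⁻¹ = δ := by rw [hη]; field_simp; norm_num
      have e2 : 0 < η * (R ^ 2)⁻¹ := by positivity
      linarith
    · exfalso
      have hloc : IsLocalMax h y := by
        refine hymax.isLocalMax ?_
        have h3 : ball c R ∩ (closedBall c (R / 2))ᶜ ∈ 𝓝 y :=
          (isOpen_ball.inter isClosed_closedBall.isOpen_compl).mem_nhds
            ⟨by simpa [dist_eq_norm] using h1, by simpa [dist_eq_norm] using h2⟩
        filter_upwards [h3] with x hx
        exact ⟨ball_subset_closedBall hx.1, fun hx2 => hx.2 (ball_subset_closedBall hx2)⟩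
      have htr := hessianTrace_nonpos_of_isLocalMax (hhdiff y hy) hloc
      rw [hh, hessianTrace_add (hf y hy.1) (contDiffAt_smul_normSq_rpow _ _ (hTne y hy)),
        hessianTrace_const_smul, hessianTrace_normSq_rpow _ (hTne y hy),
        hharm y (by simpa [dist_eq_norm] using h1)] at htr
      have hpos : 0 < ‖y - c‖ := by linarith
      have : 0 < (‖y - c‖ ^ 2) ^ ((-1 : ℝ) - 1) := Real.rpow_pos_of_pos (by positivity) _
      have : 0 < η * (2 * -1 * (2 * -1 + 1) * (‖y - c‖ ^ 2) ^ ((-1 : ℝ) - 1)) := by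
        refine mul_pos hηpos (mul_pos (by norm_num) this)
      linarith
  -- Along the radius from `z` to the centre, `f` drops at least as fast as the barrier grows.
  intro hcrit
  set g : ℝ → ℝ := fun t => f (z + t • (c - z)) + η * (((1 - t) * R) ^ 2)⁻¹ with hg
  have hline : HasDerivAt (fun t : ℝ => z + t • (c - z)) (c - z) 0 := by
    simpa using ((hasDerivAt_id (0 : ℝ)).smul_const (c - z)).const_add z
  have hfz : HasFDerivAt f (0 : E3 →L[ℝ] ℝ) (z + (0 : ℝ) • (c - z)) := by
    rw [zero_smul, add_zero, ← hcrit]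
    exact ((hf z hzT.1).differentiableAt (by simp)).hasFDerivAt
  have hder : HasDerivAt g (2 * η * (R ^ 2)⁻¹) 0 := by
    have h1 : HasDerivAt (fun t : ℝ => f (z + t • (c - z))) 0 0 :=
      HasFDerivAt.comp_hasDerivAt (f := fun t : ℝ => z + t • (c - z)) 0 hfz hline
    have h2 : HasDerivAt (fun t : ℝ => ((1 - t) * R) ^ 2) (-2 * R ^ 2) 0 := by
      have := ((((hasDerivAt_id (0 : ℝ)).const_sub 1).mul_const R).pow 2)
      convert! this using 1
      simp
      ring
    have h3 := h1.add ((h2.inv (by simp [hRpos.ne'])).const_mul η)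
    convert! h3 using 1
    simp
    field_simp
  have hg0 : g 0 = M + η * (R ^ 2)⁻¹ := by simp [hg, hz]
  have hgle : ∀ t ∈ Set.Icc (0 : ℝ) (1 / 2), g t ≤ g 0 := by
    intro t ht
    have hd : z + t • (c - z) - c = (1 - t) • (z - c) := by module
    have hnorm : ‖z + t • (c - z) - c‖ = (1 - t) * R := by
      rw [hd, norm_smul, Real.norm_of_nonneg (by linarith [ht.2])]
    have hmem : z + t • (c - z) ∈ T := by
      refine ⟨?_, ?_⟩
      · rw [mem_closedBall, dist_eq_norm, hnorm]
        nlinarith [ht.1]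
      · rw [mem_ball, dist_eq_norm, hnorm, not_lt]
        nlinarith [ht.2]
    have := hbound _ hmem
    rw [hg0]
    simpa [hg, hh, hbval, hnorm] using this
  have hneg : 2 * η * (R ^ 2)⁻¹ ≤ 0 := by
    have hw := hder.hasDerivWithinAt (s := Set.Ioi 0)
    rw [hasDerivWithinAt_iff_tendsto_slope' (by simp)] at hw
    refine le_of_tendsto hw ?_
    filter_upwards [Ioo_mem_nhdsGT (show (0 : ℝ) < 1 / 2 by norm_num)] with t ht
    rw [slope_def_field]
    exact div_nonpos_of_nonpos_of_nonneg (by linarith [hgle t ⟨ht.1.le, ht.2.le⟩])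
      (by linarith [ht.1])
  have : 0 < 2 * η * (R ^ 2)⁻¹ := by positivity
  linarith

/-- The strong maximum principle: a function harmonic near a local maximum is constant near it. -/
lemma eventually_eq_of_isLocalMax {f : E3 → ℝ} {x₀ : E3} (hf : ∀ᶠ x in 𝓝 x₀, ContDiffAt ℝ 2 f x)
    (hharm : ∀ᶠ x in 𝓝 x₀, hessianTrace f x = 0) (hmax : IsLocalMax f x₀) :
    ∀ᶠ x in 𝓝 x₀, f x = f x₀ := by
  obtain ⟨r, hr, hball⟩ := Metric.eventually_nhds_iff_ball.1 (hf.and (hharm.and hmax))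
  refine Metric.eventually_nhds_iff_ball.2 ⟨r / 2, by linarith, fun c hc => ?_⟩
  by_contra hne
  rw [mem_ball] at hc
  have hcx : dist x₀ c < r / 2 := by rwa [dist_comm]
  have hsub : closedBall c (dist x₀ c) ⊆ ball x₀ r := fun x hx => by
    rw [mem_closedBall] at hx
    rw [mem_ball]
    linarith [dist_triangle x c x₀]
  -- The point of the maximum set nearest to `c` lies on the boundary of a ball about `c` on which
  -- `f` is smaller than the maximum.
  have hcont : ContinuousOn f (closedBall c (dist x₀ c)) := fun x hx =>
    (hball x (hsub hx)).1.continuousAt.continuousWithinAt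
  have hK : IsCompact (closedBall c (dist x₀ c) ∩ f ⁻¹' {f x₀}) :=
    (isCompact_closedBall c _).of_isClosed_subset
      (hcont.preimage_isClosed_of_isClosed isClosed_closedBall isClosed_singleton)
      Set.inter_subset_left
  obtain ⟨z, ⟨hz1, hz2⟩, hzmin⟩ := hK.exists_isMinOn ⟨x₀, by simp⟩
    (f := fun x => dist x c) (by fun_prop)
  have hz2' : f z = f x₀ := hz2
  have hzc : z ≠ c := fun h => hne (h ▸ hz2')
  have hsub2 : closedBall c ‖z - c‖ ⊆ closedBall c (dist x₀ c) := by
    refine closedBall_subset_closedBall ?_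
    rw [← dist_eq_norm]
    exact hz1
  refine fderiv_ne_zero_of_lt_on_ball (f := f) (M := f x₀) hzc
    (fun x hx => (hball x (hsub (hsub2 hx))).1)
    (fun x hx => (hball x (hsub (hsub2 (ball_subset_closedBall hx)))).2.1) (fun x hx => ?_) hz2' ?_
  · have hxK := hsub2 (ball_subset_closedBall hx)
    refine lt_of_le_of_ne (hball x (hsub hxK)).2.2 fun heq => ?_
    have : dist z c ≤ dist x c := hzmin ⟨hxK, heq⟩
    rw [mem_ball, ← dist_eq_norm] at hx
    linarith
  · refine IsLocalMax.fderiv_eq_zero ?_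
    filter_upwards [isOpen_ball.mem_nhds (hsub hz1)] with x hx
    rw [hz2']
    exact (hball x hx).2.2

/-- By the maximum principle and analytic continuation, a local maximum of the potential would make
it constant on the connected set `ℝ³ ∖ S`, whereas it is unbounded near every point of `S`. -/
lemma not_isLocalMax_potential {m : ℝ} (hm : 0 ≤ m) {S : Finset E3} (hS : S.Nonempty) {x₀ : E3}
    (hx₀ : x₀ ∉ S) : ¬ IsLocalMax (potential m S) x₀ := by
  intro hmax
  have hopen : (S : Set E3)ᶜ ∈ 𝓝 x₀ := S.finite_toSet.isClosed.isOpen_compl.mem_nhds hx₀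
  have hloc : ∀ᶠ x in 𝓝 x₀, potential m S x = potential m S x₀ :=
    eventually_eq_of_isLocalMax
      (by filter_upwards [hopen] with x hx using contDiffAt_potential m hx)
      (by filter_upwards [hopen] with x hx using hessianTrace_potential m hx) hmax
  have hrank : 1 < Module.rank ℝ E3 := by
    rw [← Module.finrank_eq_rank, finrank_euclideanSpace_fin]
    norm_num
  have hconn := S.finite_toSet.countable.isConnected_compl_of_one_lt_rank hrank
  have heq : Set.EqOn (potential m S) (fun _ => potential m S x₀) (S : Set E3)ᶜ :=
    AnalyticOnNhd.eqOn_of_preconnected_of_eventuallyEq (𝕜 := ℝ)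
      (fun x hx => (contDiffAt_potential m hx).analyticAt) analyticOnNhd_const
      hconn.isPreconnected hx₀ hloc
  obtain ⟨p, hp⟩ := hS
  have hlim : Tendsto (fun x : E3 => 1 / (2 * ‖x - p‖)) (𝓝[≠] p) atTop := by
    have h1 : Tendsto (fun x : E3 => 2 * ‖x - p‖) (𝓝[≠] p) (𝓝[>] 0) := by
      refine tendsto_nhdsWithin_iff.2 ⟨?_, ?_⟩
      · have : Continuous fun x : E3 => 2 * ‖x - p‖ := by fun_prop
        simpa using this.continuousAt.tendsto.mono_left (nhdsWithin_le_nhds (a := p) (s := {p}ᶜ))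
      · filter_upwards [self_mem_nhdsWithin] with x hx
        have : x - p ≠ 0 := sub_ne_zero.2 hx
        simpa using this
    simp only [one_div]
    exact h1.inv_tendsto_nhdsGT_zero
  have hoff : ∀ᶠ x in 𝓝[≠] p, x ∉ S := by
    have : ((S : Set E3) \ {p})ᶜ ∈ 𝓝 p :=
      (S.finite_toSet.subset Set.sdiff_subset).isClosed.isOpen_compl.mem_nhds (by simp)
    filter_upwards [nhdsWithin_le_nhds this, self_mem_nhdsWithin] with x hx hxp hxS
    exact hx ⟨hxS, hxp⟩
  obtain ⟨x, hx1, hx2⟩ := ((hlim.eventually_gt_atTop (potential m S x₀)).and hoff).exists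
  have hge : 1 / (2 * ‖x - p‖) ≤ potential m S x := by
    have := Finset.single_le_sum (f := fun p : E3 => 1 / (2 * ‖x - p‖))
      (fun q _ => by positivity) hp
    unfold potential
    linarith
  have : potential m S x = potential m S x₀ := heq hx2
  linarith

end MaximumPrinciple

/-! ### The gauge potential -/

section GaugePotential

/-- The potential of a Dirac monopole at `p`, with sign `b`; the sum of these is the gauge
potential. -/
noncomputable def monopole (b : Bool) (p x : E3) : Fin 3 → ℝ :=
  (sgn b / (2 * ‖x - p‖ * (‖x - p‖ + sgn b * (x 2 - p 2)))) • ![-(x 1 - p 1), x 0 - p 0, 0]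

lemma gaugePotential_apply (S : Finset E3) (s : Gauge) (x : E3) (k : Fin 3) :
    gaugePotential S s x k = ∑ p ∈ S, monopole (s p) p x k := by
  simp only [gaugePotential, monopole, Finset.sum_apply]

lemma sgn_mul_self (b : Bool) : sgn b * sgn b = 1 := by
  cases b <;> simp [sgn]

lemma hasFDerivAt_norm_sub {p x : E3} (h : x ≠ p) :
    HasFDerivAt (fun y => ‖y - p‖) (‖x - p‖⁻¹ • innerSL ℝ (x - p)) x := by
  have h1 := hasFDerivAt_normSq_rpow (1 / 2) h
  have h2 : (fun y : E3 => (‖y - p‖ ^ 2) ^ (1 / 2 : ℝ)) = fun y => ‖y - p‖ := by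
    funext y
    rw [← Real.sqrt_eq_rpow, Real.sqrt_sq (norm_nonneg _)]
  rw [h2] at h1
  convert! h1 using 2
  rw [show (1 / 2 - 1 : ℝ) = -(1 / 2) by norm_num, Real.rpow_neg (by positivity),
    ← Real.sqrt_eq_rpow, Real.sqrt_sq (norm_nonneg _)]
  ring

lemma hasFDerivAt_inv_norm_sub {p x : E3} (h : x ≠ p) :
    HasFDerivAt (fun y => 1 / (2 * ‖y - p‖))
      (-((2 * ‖x - p‖) ^ 2)⁻¹ • (2 : ℝ) • ‖x - p‖⁻¹ • innerSL ℝ (x - p)) x := by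
  have hrpos : 0 < ‖x - p‖ := norm_pos_iff.2 (sub_ne_zero.2 h)
  refine ((hasDerivAt_inv (mul_pos two_pos hrpos).ne').comp_hasFDerivAt x
    ((hasFDerivAt_norm_sub h).const_mul 2)).congr_of_eventuallyEq ?_
  exact Filter.Eventually.of_forall fun y => by simp

/-- The potential of one monopole satisfies `dA = - ⋆ d (1 / 2r)`, in components. -/
lemma curl_monopole {b : Bool} {p x : E3} (h : x ≠ p)
    (hb : 0 < ‖x - p‖ + sgn b * (x 2 - p 2)) :
    (∀ k, DifferentiableAt ℝ (fun y => monopole b p y k) x) ∧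
      fderiv ℝ (fun y => monopole b p y 1) x (EuclideanSpace.single 0 1) -
          fderiv ℝ (fun y => monopole b p y 0) x (EuclideanSpace.single 1 1) =
        -fderiv ℝ (fun y => 1 / (2 * ‖y - p‖)) x (EuclideanSpace.single 2 1) ∧
      fderiv ℝ (fun y => monopole b p y 2) x (EuclideanSpace.single 1 1) -
          fderiv ℝ (fun y => monopole b p y 1) x (EuclideanSpace.single 2 1) =
        -fderiv ℝ (fun y => 1 / (2 * ‖y - p‖)) x (EuclideanSpace.single 0 1) ∧
      fderiv ℝ (fun y => monopole b p y 0) x (EuclideanSpace.single 2 1) -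
          fderiv ℝ (fun y => monopole b p y 2) x (EuclideanSpace.single 0 1) =
        -fderiv ℝ (fun y => 1 / (2 * ‖y - p‖)) x (EuclideanSpace.single 1 1) := by
  have hr : HasFDerivAt (fun y : E3 => ‖y - p‖) (‖x - p‖⁻¹ • innerSL ℝ (x - p)) x :=
    hasFDerivAt_norm_sub h
  have hrpos : 0 < ‖x - p‖ := norm_pos_iff.2 (sub_ne_zero.2 h)
  have hu : ∀ k, HasFDerivAt (fun y : E3 => y k - p k) (EuclideanSpace.proj k : E3 →L[ℝ] ℝ) x :=
    fun k => (EuclideanSpace.proj k : E3 →L[ℝ] ℝ).hasFDerivAt.sub_const (p k)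
  have hden := (hr.const_mul 2).mul (hr.add ((hu 2).const_mul (sgn b)))
  have hdne : 2 * ‖x - p‖ * (‖x - p‖ + sgn b * (x 2 - p 2)) ≠ 0 := by positivity
  have hw := (((hasDerivAt_inv hdne).comp_hasFDerivAt x hden).const_mul (sgn b))
  have h0 : HasFDerivAt (fun y => monopole b p y 0) _ x :=
    (hw.mul (hu 1).neg).congr_of_eventuallyEq
      (Filter.Eventually.of_forall fun y => by simp [monopole, div_eq_mul_inv])
  have h1 : HasFDerivAt (fun y => monopole b p y 1) _ x :=
    (hw.mul (hu 0)).congr_of_eventuallyEq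
      (Filter.Eventually.of_forall fun y => by simp [monopole, div_eq_mul_inv])
  have h2 : HasFDerivAt (fun y => monopole b p y 2) (0 : E3 →L[ℝ] ℝ) x :=
    (hasFDerivAt_const (0 : ℝ) x).congr_of_eventuallyEq
      (Filter.Eventually.of_forall fun y => by simp [monopole])
  have hsq : ‖x - p‖ ^ 2 = (x 0 - p 0) ^ 2 + (x 1 - p 1) ^ 2 + (x 2 - p 2) ^ 2 := by
    rw [EuclideanSpace.norm_sq_eq]
    simp [Fin.sum_univ_three]
  refine ⟨fun k => ?_, ?_⟩
  · fin_cases k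
    exacts [h0.differentiableAt, h1.differentiableAt, h2.differentiableAt]
  · rw [h0.fderiv, h1.fderiv, h2.fderiv, (hasFDerivAt_inv_norm_sub h).fderiv]
    have hs := sgn_mul_self b
    have hin : ∀ k : Fin 3, innerSL ℝ (x - p) (EuclideanSpace.single k 1) = x k - p k := fun k => by
      rw [innerSL_apply_apply, EuclideanSpace.inner_single_right]
      simp
    have hpr : ∀ k l : Fin 3, (EuclideanSpace.proj k : E3 →L[ℝ] ℝ) (EuclideanSpace.single l 1) =
        if k = l then 1 else 0 := fun k l => by
      simp
    simp only [add_apply, smul_apply, smul_eq_mul, hin, hpr, zero_apply, neg_apply,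
      Function.comp_apply, Pi.mul_apply, Pi.add_apply, Pi.neg_apply, Fin.reduceEq, if_true,
      if_false]
    generalize sgn b = σ at *
    generalize ‖x - p‖ = r at *
    generalize x 0 - p 0 = u0 at *
    generalize x 1 - p 1 = u1 at *
    generalize x 2 - p 2 = u2 at *
    have hbne := hb.ne'
    have hrne := hrpos.ne'
    clear h0 h1 h2 hw hden hr hu hin hpr
    refine ⟨?_, ?_, ?_⟩ <;> field_simp
    · linear_combination σ * (2 * r + σ * u2) * hsq + r ^ 2 * u2 * hs
    · linear_combination r ^ 2 * u0 * hs
    · linear_combination r ^ 2 * u1 * hs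

/-- At a critical point of the potential the connection is flat. -/
lemma curl_gaugePotential_eq_zero {m : ℝ} {S : Finset E3} {s : Gauge} {x : E3} (hx : x ∉ S)
    (hs : x ∈ gaugeDomain S s) (hcrit : fderiv ℝ (potential m S) x = 0) :
    (∀ k, DifferentiableAt ℝ (fun y => gaugePotential S s y k) x) ∧
      ∀ i j, fderiv ℝ (fun y => gaugePotential S s y j) x (EuclideanSpace.single i 1) =
        fderiv ℝ (fun y => gaugePotential S s y i) x (EuclideanSpace.single j 1) := by
  have hne : ∀ p ∈ S, x ≠ p := fun p hp h => hx (h ▸ hp)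
  have hA : ∀ k, (fun y => gaugePotential S s y k) = fun y => ∑ p ∈ S, monopole (s p) p y k :=
    fun k => funext fun y => gaugePotential_apply S s y k
  have hd : ∀ k, ∀ p ∈ S, DifferentiableAt ℝ (fun y => monopole (s p) p y k) x := fun k p hp =>
    (curl_monopole (hne p hp) (hs p hp)).1 k
  have hφ : ∀ v, ∑ p ∈ S, fderiv ℝ (fun y : E3 => 1 / (2 * ‖y - p‖)) x v = 0 := fun v => by
    have h1 : fderiv ℝ (potential m S) x =
        ∑ p ∈ S, fderiv ℝ (fun y : E3 => 1 / (2 * ‖y - p‖)) x := by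
      rw [← fderiv_fun_sum fun p hp => (hasFDerivAt_inv_norm_sub (hne p hp)).differentiableAt]
      exact fderiv_const_add (f := fun y : E3 => ∑ p ∈ S, 1 / (2 * ‖y - p‖)) m
    rw [hcrit] at h1
    simpa using (congrArg (fun L : E3 →L[ℝ] ℝ => L v) h1).symm
  have hcurl : ∀ i j k, (∀ p ∈ S,
      fderiv ℝ (fun y => monopole (s p) p y j) x (EuclideanSpace.single i 1) -
        fderiv ℝ (fun y => monopole (s p) p y i) x (EuclideanSpace.single j 1) =
      -fderiv ℝ (fun y : E3 => 1 / (2 * ‖y - p‖)) x (EuclideanSpace.single k 1)) →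
      fderiv ℝ (fun y => gaugePotential S s y j) x (EuclideanSpace.single i 1) =
        fderiv ℝ (fun y => gaugePotential S s y i) x (EuclideanSpace.single j 1) := by
    intro i j k h
    rw [hA, hA, fderiv_fun_sum (hd j), fderiv_fun_sum (hd i), sum_apply, sum_apply, ← sub_eq_zero,
      ← Finset.sum_sub_distrib, Finset.sum_congr rfl h, Finset.sum_neg_distrib, hφ, neg_zero]
  have h01 := hcurl 0 1 2 fun p hp => (curl_monopole (hne p hp) (hs p hp)).2.1
  have h12 := hcurl 1 2 0 fun p hp => (curl_monopole (hne p hp) (hs p hp)).2.2.1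
  have h20 := hcurl 2 0 1 fun p hp => (curl_monopole (hne p hp) (hs p hp)).2.2.2
  refine ⟨fun k => ?_, fun i j => ?_⟩
  · rw [hA]
    exact DifferentiableAt.fun_sum (hd k)
  · fin_cases i <;> fin_cases j
    exacts [rfl, h01, h20.symm, h01.symm, rfl, h12, h20, h12.symm, rfl]

end GaugePotential

/-! ### Christoffel symbols and curvature along a fibre -/

section Christoffel

open Filter Topology

/-- The projection `(θ, μ) ↦ μ` in coordinates. -/
noncomputable def baseProj : (Fin 4 → ℝ) →L[ℝ] E3 :=
  ((EuclideanSpace.equiv (Fin 3) ℝ).symm : (Fin 3 → ℝ) →L[ℝ] E3) ∘L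
    ContinuousLinearMap.pi fun i => ContinuousLinearMap.proj i.succ

lemma baseProj_apply (y : Fin 4 → ℝ) : baseProj y = WithLp.toLp 2 fun i => y i.succ := rfl

lemma baseProj_single_zero (c : ℝ) : baseProj (Pi.single 0 c) = 0 := by
  ext i
  simp [baseProj_apply]

lemma baseProj_single_succ (i : Fin 3) : baseProj (Pi.single i.succ 1) =
    EuclideanSpace.single i 1 := by
  ext j
  simp [baseProj_apply, Pi.single_apply]

variable {m : ℝ} {S : Finset E3} {s : Gauge} {y : Fin 4 → ℝ}

lemma metricMatrix_zero_zero :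
    metricMatrix m S s y 0 0 = (potential m S (baseProj y))⁻¹ := by
  simp [metricMatrix, metric, toFrame, baseProj_apply]

lemma metricMatrix_zero_succ (k : Fin 3) : metricMatrix m S s y 0 k.succ =
    (potential m S (baseProj y))⁻¹ * gaugePotential S s (baseProj y) k := by
  simp [metricMatrix, metric, toFrame, baseProj_apply, Pi.single_apply, (Fin.succ_ne_zero k).symm]

lemma metricMatrix_succ_succ (i j : Fin 3) : metricMatrix m S s y i.succ j.succ =
    (potential m S (baseProj y))⁻¹ *
        (gaugePotential S s (baseProj y) i * gaugePotential S s (baseProj y) j) +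
      potential m S (baseProj y) * if i = j then 1 else 0 := by
  simp [metricMatrix, metric, toFrame, baseProj_apply, Pi.single_apply, eq_comm]

lemma metricMatrix_symm (i j : Fin 4) : metricMatrix m S s y i j = metricMatrix m S s y j i := by
  simp only [metricMatrix, Matrix.of_apply, metric, mul_comm]

lemma det_metricMatrix (h : potential m S (baseProj y) ≠ 0) :
    (metricMatrix m S s y).det = potential m S (baseProj y) ^ 2 := by
  have e1 : (1 : Fin 4) = Fin.succ 0 := rfl
  have e2 : (2 : Fin 4) = Fin.succ 1 := rfl
  have e3 : (3 : Fin 4) = Fin.succ 2 := rfl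
  have hM : metricMatrix m S s y = !![
      metricMatrix m S s y 0 0, metricMatrix m S s y 0 1, metricMatrix m S s y 0 2,
        metricMatrix m S s y 0 3;
      metricMatrix m S s y 0 1, metricMatrix m S s y 1 1, metricMatrix m S s y 1 2,
        metricMatrix m S s y 1 3;
      metricMatrix m S s y 0 2, metricMatrix m S s y 1 2, metricMatrix m S s y 2 2,
        metricMatrix m S s y 2 3;
      metricMatrix m S s y 0 3, metricMatrix m S s y 1 3, metricMatrix m S s y 2 3,
        metricMatrix m S s y 3 3] := by
    ext i j
    fin_cases i <;> fin_cases j <;> first | rfl | exact metricMatrix_symm _ _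
  rw [hM, e1, e2, e3]
  simp only [metricMatrix_zero_zero, metricMatrix_zero_succ, metricMatrix_succ_succ]
  simp [Matrix.det_succ_row_zero, Fin.sum_univ_succ, Fin.succAbove]
  field_simp
  ring

lemma metricMatrix_add_single_zero (y : Fin 4 → ℝ) (c : ℝ) :
    metricMatrix m S s (y + Pi.single 0 c) = metricMatrix m S s y := by
  have h : baseProj (y + Pi.single 0 c) = baseProj y := by
    rw [map_add, baseProj_single_zero, add_zero]
  simp only [baseProj_apply] at h
  simp only [metricMatrix, h]

section Invariance

variable {n : ℕ} {i : Fin n}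

/-- No differentiability is needed, since the derivative of a function that is not differentiable
is zero by convention. -/
lemma partialD_eq_zero_of_invariant {F : (Fin n → ℝ) → ℝ}
    (hF : ∀ y c, F (y + Pi.single i c) = F y) (y : Fin n → ℝ) : partialD i F y = 0 := by
  by_cases hd : DifferentiableAt ℝ F y
  · have hline : HasDerivAt (fun t : ℝ => y + t • Pi.single i (1 : ℝ)) (Pi.single i 1) 0 := by
      simpa using ((hasDerivAt_id (0 : ℝ)).smul_const (Pi.single i (1 : ℝ))).const_add y
    have hd' : HasFDerivAt F (fderiv ℝ F y) (y + (0 : ℝ) • Pi.single i (1 : ℝ)) := by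
      simpa using hd.hasFDerivAt
    have h1 := hd'.comp_hasDerivAt (0 : ℝ) hline
    have h2 : (F ∘ fun t : ℝ => y + t • Pi.single i (1 : ℝ)) = fun _ => F y := by
      funext t
      rw [Function.comp_apply, ← Pi.single_smul, hF]
    rw [h2] at h1
    exact h1.unique (hasDerivAt_const _ _)
  · simp [partialD, fderiv_zero_of_not_differentiableAt hd]

lemma partialD_invariant {F : (Fin n → ℝ) → ℝ} (hF : ∀ y c, F (y + Pi.single i c) = F y)
    (j : Fin n) (y : Fin n → ℝ) (c : ℝ) : partialD j F (y + Pi.single i c) = partialD j F y := by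
  unfold partialD
  rw [← fderiv_comp_add_right]
  simp only [hF]

end Invariance

lemma partialD_zero_metricMatrix (i j : Fin 4) (y : Fin 4 → ℝ) :
    partialD 0 (fun z => metricMatrix m S s z i j) y = 0 :=
  partialD_eq_zero_of_invariant (fun y c => by rw [metricMatrix_add_single_zero]) y

lemma christoffel_add_single_zero (l i j : Fin 4) (y : Fin 4 → ℝ) (c : ℝ) :
    christoffel (metricMatrix m S s) l i j (y + Pi.single 0 c) =
      christoffel (metricMatrix m S s) l i j y := by
  have h : ∀ (k a b : Fin 4),
      partialD k (fun z => metricMatrix m S s z a b) (y + Pi.single 0 c) =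
        partialD k (fun z => metricMatrix m S s z a b) y := fun k a b =>
    partialD_invariant (fun y c => by rw [metricMatrix_add_single_zero]) k y c
  simp only [christoffel, h, metricMatrix_add_single_zero]

/-- The circle action is isometric, so only the derivatives of `g₀₀ = φ⁻¹` survive in `Γˡ₀₀`. -/
lemma christoffel_zero_zero (l : Fin 4) (y : Fin 4 → ℝ) :
    christoffel (metricMatrix m S s) l 0 0 y = ∑ k, -(1 / 2) * (metricMatrix m S s y)⁻¹ l k *
      partialD k (fun z => (potential m S (baseProj z))⁻¹) y := by
  simp only [christoffel, partialD_zero_metricMatrix, Finset.mul_sum, metricMatrix_zero_zero]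
  refine Finset.sum_congr rfl fun k _ => ?_
  ring

lemma hasFDerivAt_inv_potential (hφ : potential m S (baseProj y) ≠ 0) (hx : baseProj y ∉ S) :
    HasFDerivAt (fun z => (potential m S (baseProj z))⁻¹)
      (-(potential m S (baseProj y) ^ 2)⁻¹ • fderiv ℝ (potential m S) (baseProj y) ∘L baseProj)
      y :=
  (hasDerivAt_inv hφ).comp_hasFDerivAt y
    (((contDiffAt_potential (n := 1) m hx).differentiableAt (by simp)).hasFDerivAt.comp y
      baseProj.hasFDerivAt)

/-- The vertical field is Killing and its dual form `φ⁻¹ η` is closed at a critical point of `φ`,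
so it is parallel there. -/
lemma christoffel_zero_left (hφ : potential m S (baseProj y) ≠ 0) (hx : baseProj y ∉ S)
    (hs : baseProj y ∈ gaugeDomain S s) (hcrit : fderiv ℝ (potential m S) (baseProj y) = 0)
    (l j : Fin 4) : christoffel (metricMatrix m S s) l 0 j y = 0 := by
  obtain ⟨hAd, hcurl⟩ := curl_gaugePotential_eq_zero hx hs hcrit
  have hinv : HasFDerivAt (fun z => (potential m S (baseProj z))⁻¹)
      (0 : (Fin 4 → ℝ) →L[ℝ] ℝ) y := by
    have := hasFDerivAt_inv_potential hφ hx
    rwa [hcrit, ContinuousLinearMap.zero_comp, smul_zero] at this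
  have h00 : ∀ k, partialD k (fun z => metricMatrix m S s z 0 0) y = 0 := fun k => by
    simp only [partialD, metricMatrix_zero_zero, hinv.fderiv, zero_apply]
  have h0s : ∀ i k : Fin 3, partialD i.succ (fun z => metricMatrix m S s z 0 k.succ) y =
      (potential m S (baseProj y))⁻¹ *
        fderiv ℝ (fun x => gaugePotential S s x k) (baseProj y) (EuclideanSpace.single i 1) := by
    intro i k
    have h1 : HasFDerivAt (fun z => gaugePotential S s (baseProj z) k) _ y :=
      (hAd k).hasFDerivAt.comp y baseProj.hasFDerivAt
    have h2 := (hinv.mul h1).fderiv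
    simp only [partialD, metricMatrix_zero_succ]
    refine (congrArg (fun L : (Fin 4 → ℝ) →L[ℝ] ℝ => L (Pi.single i.succ 1)) h2).trans ?_
    simp [baseProj_single_succ]
  have hz : ∀ k, partialD j (fun z => metricMatrix m S s z 0 k) y =
      partialD k (fun z => metricMatrix m S s z 0 j) y := by
    intro k
    refine Fin.cases ?_ (fun j => ?_) j
    · rw [partialD_zero_metricMatrix, h00]
    · refine Fin.cases ?_ (fun k => ?_) k
      · rw [partialD_zero_metricMatrix, h00]
      · rw [h0s, h0s, hcurl]
  simp only [christoffel, partialD_zero_metricMatrix, hz]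
  simp

lemma continuousAt_inv_metricMatrix (hφ : potential m S (baseProj y) ≠ 0) (hx : baseProj y ∉ S)
    (hs : baseProj y ∈ gaugeDomain S s) (hcrit : fderiv ℝ (potential m S) (baseProj y) = 0)
    (l k : Fin 4) :
    ContinuousAt (fun z => (metricMatrix m S s z)⁻¹ l k) y := by
  have hAd := (curl_gaugePotential_eq_zero hx hs hcrit).1
  have hp : ContinuousAt (fun z => potential m S (baseProj z)) y :=
    (contDiffAt_potential (n := 1) m hx).continuousAt.comp baseProj.continuous.continuousAt
  have hA : ∀ k, ContinuousAt (fun z => gaugePotential S s (baseProj z) k) y := fun k =>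
    ContinuousAt.comp (f := fun z => baseProj z) (hAd k).continuousAt
      baseProj.continuous.continuousAt
  have hM : ContinuousAt (metricMatrix m S s) y := by
    refine continuousAt_pi.2 fun i => continuousAt_pi.2 fun j => ?_
    refine Fin.cases ?_ (fun i => ?_) i <;> refine Fin.cases ?_ (fun j => ?_) j
    · simp only [metricMatrix_zero_zero]
      exact hp.inv₀ hφ
    · simp only [metricMatrix_zero_succ]
      exact (hp.inv₀ hφ).mul (hA j)
    · simp only [metricMatrix_symm i.succ 0, metricMatrix_zero_succ]
      exact (hp.inv₀ hφ).mul (hA i)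
    · simp only [metricMatrix_succ_succ]
      exact ((hp.inv₀ hφ).mul ((hA i).mul (hA j))).add (hp.mul continuousAt_const)
  have hdet : (metricMatrix m S s y).det ≠ 0 := by
    rw [det_metricMatrix hφ]
    exact pow_ne_zero 2 hφ
  have hcontdet : ContinuousAt (fun z => (metricMatrix m S s z).det) y :=
    ContinuousAt.comp (f := metricMatrix m S s) (continuous_id.matrix_det.continuousAt) hM
  have hcontadj : ContinuousAt (fun z => (metricMatrix m S s z).adjugate l k) y :=
    ContinuousAt.comp (f := metricMatrix m S s)
      ((continuous_id.matrix_adjugate.matrix_elem l k).continuousAt) hM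
  simp only [Matrix.inv_def, Matrix.smul_apply, smul_eq_mul, Ring.inverse_eq_inv']
  exact (hcontdet.inv₀ hdet).mul hcontadj

/-- Where `dφ` vanishes to second order, so does `Γˡ₀₀`. -/
lemma hasFDerivAt_christoffel_zero_zero (hφ : potential m S (baseProj y) ≠ 0) (hx : baseProj y ∉ S)
    (hs : baseProj y ∈ gaugeDomain S s) (hcrit : fderiv ℝ (potential m S) (baseProj y) = 0)
    (hhess : fderiv ℝ (fderiv ℝ (potential m S)) (baseProj y) = 0) (l : Fin 4) :
    HasFDerivAt (christoffel (metricMatrix m S s) l 0 0) (0 : (Fin 4 → ℝ) →L[ℝ] ℝ) y := by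
  have hbase : ContinuousAt baseProj y := baseProj.continuous.continuousAt
  have hp : ContinuousAt (fun z => potential m S (baseProj z)) y :=
    (contDiffAt_potential (n := 1) m hx).continuousAt.comp hbase
  have hev : ∀ k, partialD k (fun z => (potential m S (baseProj z))⁻¹) =ᶠ[𝓝 y] fun z =>
      -(potential m S (baseProj z) ^ 2)⁻¹ *
        fderiv ℝ (potential m S) (baseProj z) (baseProj (Pi.single k 1)) := by
    intro k
    have hopen : (S : Set E3)ᶜ ∈ 𝓝 (baseProj y) := S.finite_toSet.isClosed.isOpen_compl.mem_nhds hx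
    filter_upwards [hbase hopen, hp.eventually_ne hφ] with z hz1 hz2
    rw [partialD, (hasFDerivAt_inv_potential hz2 hz1).fderiv]
    rfl
  have hD : HasFDerivAt (fderiv ℝ (potential m S)) (0 : E3 →L[ℝ] E3 →L[ℝ] ℝ) (baseProj y) := by
    rw [← hhess]
    exact (((contDiffAt_potential (n := 2) m hx).fderiv_right (m := 1)
      (by norm_num)).differentiableAt (by simp)).hasFDerivAt
  have hDk : ∀ v, HasFDerivAt (fun z => fderiv ℝ (potential m S) (baseProj z) v)
      (0 : (Fin 4 → ℝ) →L[ℝ] ℝ) y := fun v => by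
    have h1 := (ContinuousLinearMap.apply ℝ ℝ v).hasFDerivAt.comp y
      (hD.comp y baseProj.hasFDerivAt)
    rw [ContinuousLinearMap.zero_comp, ContinuousLinearMap.comp_zero] at h1
    exact h1
  have hsum : HasFDerivAt (fun z => ∑ k : Fin 4,
      (-(1 / 2) * (metricMatrix m S s z)⁻¹ l k * -(potential m S (baseProj z) ^ 2)⁻¹) *
        fderiv ℝ (potential m S) (baseProj z) (baseProj (Pi.single k 1)))
      (∑ _k : Fin 4, (0 : (Fin 4 → ℝ) →L[ℝ] ℝ)) y := by
    refine HasFDerivAt.fun_sum fun k _ => hasFDerivAt_mul_zero ?_ (hDk _) (by rw [hcrit]; rfl)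
    exact ((continuousAt_const.mul (continuousAt_inv_metricMatrix hφ hx hs hcrit l k)).mul
      ((hp.pow 2).inv₀ (pow_ne_zero 2 hφ)).neg)
  rw [Finset.sum_const_zero] at hsum
  refine hsum.congr_of_eventuallyEq ?_
  filter_upwards [eventually_all.2 hev] with z hz
  rw [christoffel_zero_zero]
  refine Finset.sum_congr rfl fun k _ => ?_
  rw [hz k, mul_assoc _ (-(potential m S (baseProj z) ^ 2)⁻¹)]

/-- The curvature vanishes on planes containing the vertical direction. -/
lemma riemannCoeff_vertical (hφ : potential m S (baseProj y) ≠ 0) (hx : baseProj y ∉ S)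
    (hs : baseProj y ∈ gaugeDomain S s) (hcrit : fderiv ℝ (potential m S) (baseProj y) = 0)
    (hhess : fderiv ℝ (fderiv ℝ (potential m S)) (baseProj y) = 0)
    (l j : Fin 4) : riemannCoeff (metricMatrix m S s) l 0 j 0 y = 0 := by
  have h1 : partialD 0 (christoffel (metricMatrix m S s) l j 0) y = 0 :=
    partialD_eq_zero_of_invariant (christoffel_add_single_zero l j 0) y
  have h2 : partialD j (christoffel (metricMatrix m S s) l 0 0) y = 0 := by
    rw [partialD, (hasFDerivAt_christoffel_zero_zero hφ hx hs hcrit hhess l).fderiv]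
    rfl
  simp [riemannCoeff, h1, h2, christoffel_zero_left hφ hx hs hcrit]

end Christoffel

/-! ### The circle fibres -/

section Fibres

open Filter Topology

variable {S : Finset E3} {m : ℝ}

/-- The circle above `b`, started at the point with fibre coordinate `u` in the preferred gauge. -/
noncomputable def circleLoop (b : Base S) (u : Circle) (t : ℝ) : Space S := ⟨b, u * Circle.exp t⟩

lemma fiberLoop_eq_circleLoop (b : Base S) : fiberLoop b = circleLoop b 1 := by
  funext t
  exact congrArg (fun c : Circle => (⟨b, c⟩ : Space S)) (one_mul _).symm

lemma proj_circleLoop (b : Base S) (u : Circle) (t : ℝ) : proj (circleLoop b u t) = b := rfl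

lemma fiberCoord_circleLoop (s : Gauge) (b : Base S) (u : Circle) (t : ℝ) :
    (fiberCoord s (circleLoop b u t) : ℂ) =
      (transition S ((bundleCore S).indexAt b) s b * u : Circle) * Complex.exp (t * Complex.I) := by
  have h : fiberCoord s (circleLoop b u t) =
      transition S ((bundleCore S).indexAt b) s b * (u * Circle.exp t) := rfl
  rw [h, ← mul_assoc, Circle.coe_mul, Circle.coe_exp]

lemma hasDerivAt_fiberCoord_circleLoop (s : Gauge) (b : Base S) (u : Circle) (t : ℝ) :
    HasDerivAt (fun r => (fiberCoord s (circleLoop b u r) : ℂ))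
      (fiberCoord s (circleLoop b u t) * Complex.I) t := by
  have h1 : HasDerivAt (fun r : ℝ => (r : ℂ) * Complex.I) Complex.I t := by
    simpa using (Complex.ofRealCLM.hasDerivAt (x := t)).mul_const Complex.I
  simp only [fiberCoord_circleLoop]
  convert! h1.cexp.const_mul
    ((transition S ((bundleCore S).indexAt b) s b * u : Circle) : ℂ) using 1
  ring

lemma isSmoothLoop_circleLoop (b : Base S) (u : Circle) : IsSmoothLoop (circleLoop b u) := by
  refine ⟨fun t => ?_, contDiff_const (c := (b : E3)), fun s t _ => ?_⟩
  · exact congrArg (fun c : Circle => (⟨b, u * c⟩ : Space S)) (Circle.periodic_exp t)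
  · simp only [fiberCoord_circleLoop]
    refine contDiffAt_const.mul (ContDiffAt.cexp (ContDiffAt.mul ?_ contDiffAt_const))
    exact Complex.ofRealCLM.contDiff.contDiffAt

lemma coordVelocity_circleLoop (s : Gauge) (b : Base S) (u : Circle) (t : ℝ) :
    coordVelocity s (circleLoop b u) t = Pi.single 0 1 := by
  have h0 : (fiberCoord s (circleLoop b u t) : ℂ) ≠ 0 := Circle.coe_ne_zero _
  funext i
  refine Fin.cases ?_ (fun i => ?_) i
  · simp only [coordVelocity, Fin.cons_zero]
    rw [(hasDerivAt_fiberCoord_circleLoop s b u t).deriv, mul_div_cancel_left₀ _ h0]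
    simp
  · simp [coordVelocity, proj_circleLoop]

lemma toFrame_single_zero (s : Gauge) (x : E3) :
    toFrame S s x (Pi.single 0 1) = Pi.single 0 1 := by
  funext i
  refine Fin.cases ?_ (fun i => ?_) i <;> simp [toFrame]

lemma toCoord_single_zero (s : Gauge) (x : E3) :
    toCoord S s x (Pi.single 0 1) = Pi.single 0 1 := by
  funext i
  refine Fin.cases ?_ (fun i => ?_) i <;> simp [toCoord]

lemma toFrame_toCoord (s : Gauge) (x : E3) (v : Fin 4 → ℝ) :
    toFrame S s x (toCoord S s x v) = v := by
  funext i
  refine Fin.cases ?_ (fun i => ?_) i <;> simp [toFrame, toCoord]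

lemma velocity_circleLoop (b : Base S) (u : Circle) (t : ℝ) :
    velocity (circleLoop b u) t = Pi.single 0 1 := by
  rw [velocity, coordVelocity_circleLoop, toFrame_single_zero]

lemma length_circleLoop (b : Base S) (u : Circle) :
    GibbonsHawking.length m (circleLoop b u) = 2 * Real.pi * √(potential m S b)⁻¹ := by
  simp [GibbonsHawking.length, velocity_circleLoop, proj_circleLoop, metric]

/-- The circles are shorter where the potential is larger. -/
lemma length_circleLoop_lt (hm : 0 ≤ m) (hS : S.Nonempty) {b b' : Base S} (u u' : Circle)
    (h : potential m S b < potential m S b') :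
    GibbonsHawking.length m (circleLoop b' u') < GibbonsHawking.length m (circleLoop b u) := by
  have h1 := potential_pos hm hS b.2
  have h2 := potential_pos hm hS b'.2
  rw [length_circleLoop, length_circleLoop]
  refine mul_lt_mul_of_pos_left ?_ (by positivity)
  exact Real.sqrt_lt_sqrt (by positivity) ((inv_lt_inv₀ h2 h1).2 h)

end Fibres

/-! ### Second-order stability -/

section SecondOrder

variable {S : Finset E3} {m : ℝ} {b : Base S} {u : Circle}

lemma baseProj_coords (s : Gauge) (t : ℝ) : baseProj (coords s (circleLoop b u t)) = b := by
  ext i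
  simp [baseProj_apply, coords, proj_circleLoop]

lemma hasDerivAt_toCoord (s : Gauge) (x : E3) {V : ℝ → Fin 4 → ℝ} {V' : Fin 4 → ℝ} {t : ℝ}
    (hV : HasDerivAt V V' t) :
    HasDerivAt (fun r => toCoord S s x (V r)) (toCoord S s x V') t := by
  have h := hasDerivAt_pi.1 hV
  refine hasDerivAt_pi.2 fun i => ?_
  refine Fin.cases ?_ (fun i => ?_) i
  · simp only [toCoord, Fin.cons_zero]
    exact (h 0).sub (HasDerivAt.fun_sum fun i _ => (h i.succ).const_mul _)
  · simp only [toCoord, Fin.cons_succ]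
    exact h i.succ

/-- Along the circle over a critical point of `φ` the frame is parallel. -/
lemma covDeriv_circleLoop (hφ : potential m S b ≠ 0) (hcrit : fderiv ℝ (potential m S) b = 0)
    {V : ℝ → Fin 4 → ℝ} {t : ℝ} (hV : DifferentiableAt ℝ V t) :
    covDeriv m (circleLoop b u) V t = deriv V t := by
  have hs : (b : E3) ∈ gaugeDomain S (gaugeAt (circleLoop b u t)) :=
    (bundleCore S).mem_baseSet_at b
  have hΓ : ∀ w, christoffelVec (metricMatrix m S (gaugeAt (circleLoop b u t)))
      (coords (gaugeAt (circleLoop b u t)) (circleLoop b u t)) (Pi.single 0 1) w = 0 := by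
    intro w
    funext l
    simp only [christoffelVec, Pi.zero_apply]
    refine Finset.sum_eq_zero fun i _ => Finset.sum_eq_zero fun j _ => ?_
    refine Fin.cases ?_ (fun i => ?_) i
    · rw [christoffel_zero_left] <;> simp [baseProj_coords, hφ, hcrit, hs, b.2]
    · simp
  simp only [covDeriv, coordVelocity_circleLoop, hΓ, add_zero, proj_circleLoop]
  rw [(hasDerivAt_toCoord _ _ hV.hasDerivAt).deriv, toFrame_toCoord]

lemma curvature_circleLoop (hφ : potential m S b ≠ 0) (hcrit : fderiv ℝ (potential m S) b = 0)
    (hhess : fderiv ℝ (fderiv ℝ (potential m S)) b = 0) (t : ℝ) (v : Fin 4 → ℝ) :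
    curvature m (circleLoop b u t) (Pi.single 0 1) v (Pi.single 0 1) = 0 := by
  have hs : (b : E3) ∈ gaugeDomain S (gaugeAt (circleLoop b u t)) :=
    (bundleCore S).mem_baseSet_at b
  have hR : ∀ w, riemannVec (metricMatrix m S (gaugeAt (circleLoop b u t)))
      (coords (gaugeAt (circleLoop b u t)) (circleLoop b u t)) (Pi.single 0 1) w
      (Pi.single 0 1) = 0 := by
    intro w
    funext l
    simp only [riemannVec, Pi.zero_apply]
    refine Finset.sum_eq_zero fun i _ => Finset.sum_eq_zero fun j _ =>
      Finset.sum_eq_zero fun k _ => ?_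
    refine Fin.cases ?_ (fun i => ?_) i
    · refine Fin.cases ?_ (fun k => ?_) k
      · rw [riemannCoeff_vertical] <;> simp [baseProj_coords, hφ, hcrit, hs, b.2, hhess]
      · simp
    · simp
  simp only [curvature, toCoord_single_zero, hR]
  funext i
  refine Fin.cases ?_ (fun i => ?_) i <;> simp [toFrame]

lemma isClosedGeodesic_circleLoop (hφ : potential m S b ≠ 0)
    (hcrit : fderiv ℝ (potential m S) b = 0) : IsClosedGeodesic m (circleLoop b u) := by
  refine ⟨isSmoothLoop_circleLoop b u, fun t => ?_, fun t => ?_⟩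
  · rw [velocity_circleLoop]
    exact fun h => one_ne_zero (congrFun h 0)
  · have hv : velocity (circleLoop b u) = fun _ => Pi.single 0 1 :=
      funext fun t => velocity_circleLoop b u t
    rw [hv, covDeriv_circleLoop hφ hcrit (differentiableAt_const _), deriv_const]

lemma jacobi_circleLoop (hφ : potential m S b ≠ 0) (hcrit : fderiv ℝ (potential m S) b = 0)
    (hhess : fderiv ℝ (fderiv ℝ (potential m S)) b = 0) {V : ℝ → Fin 4 → ℝ}
    (hV : ContDiff ℝ ∞ V) (t : ℝ) : jacobi m (circleLoop b u) V t = deriv (deriv V) t := by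
  have h1 : covDeriv m (circleLoop b u) V = deriv V := funext fun t =>
    covDeriv_circleLoop hφ hcrit (hV.differentiable (by simp) t)
  have hV' : ContDiff ℝ ∞ (deriv V) := (contDiff_infty_iff_deriv.1 hV).2
  rw [jacobi, h1, covDeriv_circleLoop hφ hcrit (hV'.differentiable (by simp) t),
    velocity_circleLoop, curvature_circleLoop hφ hcrit hhess, sub_zero]

lemma hasDerivAt_metric (x : E3) {V W : ℝ → Fin 4 → ℝ} {V' W' : Fin 4 → ℝ} {t : ℝ}
    (hV : HasDerivAt V V' t) (hW : HasDerivAt W W' t) :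
    HasDerivAt (fun r => metric m S x (V r) (W r))
      (metric m S x V' (W t) + metric m S x (V t) W') t := by
  have hv := hasDerivAt_pi.1 hV
  have hw := hasDerivAt_pi.1 hW
  simp only [metric]
  have h0 := ((hv 0).mul (hw 0)).const_mul (potential m S x)⁻¹
  have h1 := (HasDerivAt.fun_sum (u := Finset.univ)
    fun (i : Fin 3) _ => (hv i.succ).mul (hw i.succ)).const_mul (potential m S x)
  refine (h0.add h1).congr_deriv ?_
  simp only [Finset.sum_add_distrib]
  ring

lemma continuous_metric (x : E3) {V W : ℝ → Fin 4 → ℝ} (hV : Continuous V) (hW : Continuous W) :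
    Continuous fun r => metric m S x (V r) (W r) := by
  unfold metric
  fun_prop

lemma metric_self_nonneg {x : E3} (hφ : 0 < potential m S x) (v : Fin 4 → ℝ) :
    0 ≤ metric m S x v v :=
  add_nonneg (mul_nonneg (inv_nonneg.2 hφ.le) (mul_self_nonneg _))
    (mul_nonneg hφ.le (Finset.sum_nonneg fun _ _ => mul_self_nonneg _))

/-- Integration by parts turns the index form into `∫ g(V', V') dt`. -/
lemma indexForm_circleLoop_nonneg (hφ : 0 < potential m S b)
    (hcrit : fderiv ℝ (potential m S) b = 0)
    (hhess : fderiv ℝ (fderiv ℝ (potential m S)) b = 0) {V : ℝ → Fin 4 → ℝ}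
    (hV : ContDiff ℝ ∞ V) (hper : Function.Periodic V (2 * Real.pi)) :
    0 ≤ indexForm m (circleLoop b u) V := by
  have hV' : ContDiff ℝ ∞ (deriv V) := (contDiff_infty_iff_deriv.1 hV).2
  have hV'' : ContDiff ℝ ∞ (deriv (deriv V)) := (contDiff_infty_iff_deriv.1 hV').2
  have hint1 := (continuous_metric (m := m) (S := S) b hV'.continuous
    hV'.continuous).intervalIntegrable (μ := MeasureTheory.volume) 0 (2 * Real.pi)
  have hint2 := (continuous_metric (m := m) (S := S) b hV.continuous
    hV''.continuous).intervalIntegrable (μ := MeasureTheory.volume) 0 (2 * Real.pi)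
  have hparts := intervalIntegral.integral_eq_sub_of_hasDerivAt (fun t _ =>
    hasDerivAt_metric (m := m) (S := S) b (hV.differentiable (by simp) t).hasDerivAt
      (hV'.differentiable (by simp) t).hasDerivAt) (hint1.add hint2)
  have hper' : deriv V (2 * Real.pi) = deriv V 0 := by
    have h : (fun t => V (t + 2 * Real.pi)) = V := funext hper
    have := deriv_comp_add_const V (2 * Real.pi) 0
    rw [h, zero_add] at this
    exact this.symm
  have hper0 : V (2 * Real.pi) = V 0 := by simpa using hper 0
  rw [hper', hper0, sub_self, intervalIntegral.integral_add hint1 hint2] at hparts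
  have hpos : 0 ≤ ∫ t in (0 : ℝ)..(2 * Real.pi), metric m S b (deriv V t) (deriv V t) :=
    intervalIntegral.integral_nonneg (by positivity) fun t _ => metric_self_nonneg hφ _
  simp only [indexForm, proj_circleLoop, jacobi_circleLoop hφ.ne' hcrit hhess hV]
  linarith

lemma index_circleLoop (hφ : 0 < potential m S b) (hcrit : fderiv ℝ (potential m S) b = 0)
    (hhess : fderiv ℝ (fderiv ℝ (potential m S)) b = 0) : index m (circleLoop b u) = 0 := by
  refine le_antisymm (iSup₂_le fun W hW => ?_) bot_le
  have hbot : W = ⊥ := by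
    refine (Submodule.eq_bot_iff W).2 fun V hVW => ?_
    by_contra hne
    obtain ⟨hV, hper, -⟩ := hW.1 hVW
    exact absurd (hW.2 V hVW hne) (indexForm_circleLoop_nonneg hφ hcrit hhess hV hper).not_gt
  subst hbot
  simp

end SecondOrder

/-! ### Instability -/

section Instability

open Filter Topology

variable {S : Finset E3} {m : ℝ}

/-- Every circle has nearby circles which are close to it in the `C¹` topology. The preferred gauge
may jump at `b₀`, so the nearby circles are started at the phase that is constant in the gauge
of `b₀`. -/
lemma eventually_exists_circleLoop_mem {U : Set (ℝ × Space S × (Fin 4 → ℝ))} (hU : IsOpen U)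
    (b₀ : Base S)
    (hb₀ : ∀ t ∈ Set.Icc 0 (2 * Real.pi), (t, fiberLoop b₀ t, velocity (fiberLoop b₀) t) ∈ U) :
    ∀ᶠ b in 𝓝 b₀, ∃ u : Circle, ∀ t ∈ Set.Icc 0 (2 * Real.pi),
      (t, circleLoop b u t, velocity (circleLoop b u) t) ∈ U := by
  set s := (bundleCore S).indexAt b₀ with hs
  set e := ((bundleCore S).localTriv s).toOpenPartialHomeomorph.symm with he
  have hcont : ∀ t : ℝ, ContinuousAt (fun z : Base S × ℝ => e (z.1, Circle.exp z.2)) (b₀, t) := by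
    intro t
    have hmem : (b₀, Circle.exp t) ∈ ((bundleCore S).localTriv s).target :=
      ((bundleCore S).localTriv s).mem_target.2 ((bundleCore S).mem_baseSet_at b₀)
    have h1 : ContinuousAt e (b₀, Circle.exp t) :=
      ((bundleCore S).localTriv s).toOpenPartialHomeomorph.continuousAt_symm hmem
    exact ContinuousAt.comp (f := fun z : Base S × ℝ => (z.1, Circle.exp z.2)) h1
      (by fun_prop)
  have heq : ∀ (b : Base S) (t : ℝ), e (b, Circle.exp t) =
      circleLoop b (transition S s ((bundleCore S).indexAt b) b) t := fun _ _ => rfl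
  have hloop : ∀ t, circleLoop b₀ (transition S s ((bundleCore S).indexAt b₀) b₀) t =
      fiberLoop b₀ t := by
    intro t
    have : transition S s ((bundleCore S).indexAt b₀) b₀ = 1 := by simp [transition, hs]
    rw [this, fiberLoop_eq_circleLoop]
  have hev : ∀ᶠ b in 𝓝 b₀, ∀ t ∈ Set.Icc 0 (2 * Real.pi),
      (t, e (b, Circle.exp t), (Pi.single 0 1 : Fin 4 → ℝ)) ∈ U := by
    refine isCompact_Icc.eventually_forall_of_forall_eventually fun t ht => ?_
    have hc : ContinuousAt (fun z : Base S × ℝ =>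
        (z.2, e (z.1, Circle.exp z.2), (Pi.single 0 1 : Fin 4 → ℝ))) (b₀, t) :=
      continuousAt_snd.prodMk ((hcont t).prodMk continuousAt_const)
    refine hc (hU.mem_nhds ?_)
    have h := hb₀ t ht
    rw [fiberLoop_eq_circleLoop, velocity_circleLoop, ← fiberLoop_eq_circleLoop, ← hloop] at h
    exact h
  filter_upwards [hev] with b hb
  refine ⟨transition S s ((bundleCore S).indexAt b) b, fun t ht => ?_⟩
  rw [velocity_circleLoop, ← heq]
  exact hb t ht

lemma frequently_potential_lt (hm : 0 ≤ m) (hS : S.Nonempty) (b₀ : Base S) :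
    ∃ᶠ b : Base S in 𝓝 b₀, potential m S b₀ < potential m S b := by
  intro h
  refine not_isLocalMax_potential hm hS b₀.2 ?_
  have hopen : IsOpen {x : E3 | x ∉ S} := S.finite_toSet.isClosed.isOpen_compl
  have hmap : Filter.map ((↑) : Base S → E3) (𝓝 b₀) = 𝓝 (b₀ : E3) :=
    map_nhds_subtype_coe_eq_nhds (p := fun x => x ∉ S) b₀.2 (hopen.mem_nhds b₀.2)
  rw [IsLocalMax, IsMaxFilter, ← hmap, Filter.eventually_map]
  filter_upwards [h] with b hb
  exact not_lt.1 hb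

lemma not_isStable_fiberLoop (hm : 0 ≤ m) (hS : S.Nonempty) (b₀ : Base S) :
    ¬ IsStable m (fiberLoop b₀) := by
  rintro ⟨U, hU, hb₀, hmin⟩
  obtain ⟨b, hlt, u, hu⟩ := ((frequently_potential_lt hm hS b₀).and_eventually
    (eventually_exists_circleLoop_mem hU b₀ hb₀)).exists
  have hle := hmin _ (isSmoothLoop_circleLoop b u) hu
  rw [fiberLoop_eq_circleLoop] at hle
  exact absurd hle (length_circleLoop_lt hm hS 1 u hlt).not_ge

lemma exists_fiberLoop_length_lt (hm : 0 ≤ m) (hS : S.Nonempty) (b₀ : Base S) {ε : ℝ}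
    (hε : 0 < ε) : ∃ b : Base S, ‖(b : E3) - b₀‖ < ε ∧
      GibbonsHawking.length m (fiberLoop b) < GibbonsHawking.length m (fiberLoop b₀) := by
  obtain ⟨b, hlt, hb⟩ := ((frequently_potential_lt hm hS b₀).and_eventually
    (Metric.ball_mem_nhds b₀ hε)).exists
  refine ⟨b, ?_, ?_⟩
  · rw [← dist_eq_norm]
    exact hb
  · rw [fiberLoop_eq_circleLoop, fiberLoop_eq_circleLoop]
    exact length_circleLoop_lt hm hS 1 1 hlt

end Instability

end GibbonsHawking

open GibbonsHawking in
theorem mainTheorem5 (m : ℝ) (hm : 0 ≤ m) (S : Finset E3) (hS : S.Nonempty)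
    (h0 : (0 : E3) ∉ S)
    (hcrit : fderiv ℝ (potential m S) 0 = 0)
    (hG : invariantHarmonicQuadratics (symmetryGroup S) = ⊥) :
    fderiv ℝ (fderiv ℝ (potential m S)) 0 = 0 ∧
    IsClosedGeodesic m (fiberLoop (⟨0, h0⟩ : Base S)) ∧
    IsStableToSecondOrder m (fiberLoop (⟨0, h0⟩ : Base S)) ∧
    ¬ IsStable m (fiberLoop (⟨0, h0⟩ : Base S)) ∧
    ∀ ε > 0, ∃ b : Base S, ‖(b : E3)‖ < ε ∧
      GibbonsHawking.length m (fiberLoop b) <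
        GibbonsHawking.length m (fiberLoop (⟨0, h0⟩ : Base S)) := by
  have hφ := potential_pos hm hS h0
  have hhess := hessian_potential_eq_zero m h0 hG
  have hgeod : IsClosedGeodesic m (fiberLoop (⟨0, h0⟩ : Base S)) := by
    rw [fiberLoop_eq_circleLoop]
    exact isClosedGeodesic_circleLoop hφ.ne' hcrit
  refine ⟨hhess, hgeod, ⟨hgeod, ?_⟩, not_isStable_fiberLoop hm hS _, fun ε hε => ?_⟩
  · rw [fiberLoop_eq_circleLoop]
    exact index_circleLoop hφ hcrit hhess
  · simpa using exists_fiberLoop_length_lt hm hS ⟨0, h0⟩ hε
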